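/- Let $G=(V,E)$ be a simple graph (of arbitrary cardinality and with arbitrary vertex degrees) with $V\neq\emptyset$, and let $|G|$ be its one-complex, that is, the quotient space of $V\oplus\bigoplus_{e\in E}[0,1]_e$ ($V$ discrete) obtained by identifying, for each edge $e=\{v,w\}$, the point $0\in[0,1]_e$ with $v$ and the point $1\in[0,1]_e$ with $w$. An arc is a homeomorphic copy of $[0,1]$, and $G$ is called $4$-ac if every set of at most four points of $|G|$ is contained in an arc in $|G|$. Call $G$ cyclically connected if any two (not necessarily distinct) vertices of $G$ lie on a common cycle. A subgraph of $G$ is called a basic $4$-ac subgraph if it is a subdivision of one of the following four (multi)graphs: - the circle, so that the subgraph is a cycle; - the $\theta$-curve: two vertices $a,b$ and three parallel edges between $a$ and $b$; - the happy-face curve: three vertices $a,b,c$, two parallel edges between $a$ and $b$, two parallel edges between $a$ and $c$, and one edge $bc$; - the baguette curve: four vertices $a,b,c,d$, two parallel edges between $a$ and $b$, two parallel edges between $c$ and $d$, one edge $ac$ and one edge $bd$. **Theorem.** Let $G$ be a cyclically connected graph. Then the following are equivalent: 1. $G$ is $4$-ac; 2. there are no two distinct vertices $a,b$ of $G$ such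 that the space $|G|\setminus\{a,b\}$ has four or more connected components; 3. any four distinct edges of $G$ are contained in a common basic $4$-ac subgraph of $G$. -/

import Mathlib

/-!
Basic notions: the one-complex `|G|` of a graph, `n`-arc connectedness, cyclically connected
graphs, and the basic `4`-ac graphs (circle, theta-curve, happy-face curve, baguette curve).
-/

namespace ArcGraph

universe u

/-! ### The one-complex of a graph -/

/-- The gluing relation on `V ⊕ ⨁_{e ∈ E} [0,1]_e`: for an edge `e = {v, w}`, the point `0` of
`[0,1]_e` is identified with one end of `e` and the point `1` with the other one.  (Which end
receives `0` is fixed by an arbitrary choice of an ordered pair representing `e`.) -/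
inductive Glue {V : Type u} (G : SimpleGraph V) :
    V ⊕ (Σ _ : G.edgeSet, unitInterval) → V ⊕ (Σ _ : G.edgeSet, unitInterval) → Prop
  | zero (e : G.edgeSet) : Glue G (Sum.inr ⟨e, 0⟩) (Sum.inl (Quot.out e.1).1)
  | one (e : G.edgeSet) : Glue G (Sum.inr ⟨e, 1⟩) (Sum.inl (Quot.out e.1).2)

/-- The underlying set of `|G|`: the quotient of `V ⊕ ⨁_{e ∈ E} [0,1]_e` by the equivalence
relation generated by the gluing relation. -/
def OneComplex {V : Type u} (G : SimpleGraph V) : Type u := Quot (Glue G)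

/-- The topology of `|G|`: the quotient topology, where `V` is discrete. -/
instance {V : Type u} (G : SimpleGraph V) : TopologicalSpace (OneComplex G) :=
  letI : TopologicalSpace V := ⊥
  inferInstanceAs (TopologicalSpace (Quot (Glue G)))

/-- The point of `|G|` given by a vertex of `G`. -/
def OneComplex.vertex {V : Type u} (G : SimpleGraph V) (v : V) : OneComplex G :=
  Quot.mk (Glue G) (Sum.inl v)

/-! ### Arcs and `n`-arc connectedness -/

/-- A subset of a topological space is an arc if it is homeomorphic to `[0,1]`. -/
def IsArc {X : Type u} [TopologicalSpace X] (A : Set X) : Prop :=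
  Nonempty (A ≃ₜ unitInterval)

/-- A space is `n`-arc connected (`n`-ac) if every set of at most `n` points lies in an arc. -/
def IsArcConnected (n : ℕ) (X : Type u) [TopologicalSpace X] : Prop :=
  ∀ S : Set X, S.encard ≤ n → ∃ A : Set X, IsArc A ∧ S ⊆ A

/-- The points of a set `A` cut the space `X` into `k` or more components, i.e. `X \ A` has at
least `k` connected components (possibly infinitely many). -/
def CutsIntoAtLeast {X : Type u} [TopologicalSpace X] (A : Set X) (k : ℕ) : Prop :=
  (k : ℕ∞) ≤ ENat.card (ConnectedComponents (Aᶜ : Set X))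

/-! ### Cyclically connected graphs -/

/-- Any two (not necessarily distinct) vertices lie on a common cycle. -/
def CyclicallyConnected {V : Type u} (G : SimpleGraph V) : Prop :=
  ∀ v w : V, ∃ (x : V) (c : G.Walk x x), c.IsCycle ∧ v ∈ c.support ∧ w ∈ c.support

/-! ### Basic `4`-ac graphs -/

/-- Two walks share no edge, and meet at most in common end vertices. -/
def InternallyDisjoint {V : Type u} {G : SimpleGraph V} {a b c d : V}
    (P : G.Walk a b) (Q : G.Walk c d) : Prop :=
  P.edges.Disjoint Q.edges ∧
    ∀ z, z ∈ P.support → z ∈ Q.support → (z = a ∨ z = b) ∧ (z = c ∨ z = d)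

/-- The subgraph `H` is a subdivision of the multigraph without loops on the vertex set `Fin n`
which has `k` edges, the `i`-th one joining `s i` and `t i`: there are distinct branch vertices
`φ 0, …, φ (n - 1)` of `H`, and `H` is made up of them and of `k` independent paths, the `i`-th
one joining `φ (s i)` and `φ (t i)` and avoiding all other branch vertices. -/
def IsSubdivisionOf {V : Type u} {G : SimpleGraph V} {n k : ℕ} (s t : Fin k → Fin n)
    (H : G.Subgraph) : Prop :=
  ∃ (φ : Fin n → V) (P : ∀ i : Fin k, G.Walk (φ (s i)) (φ (t i))),
    Function.Injective φ ∧
    (∀ i, (P i).IsPath) ∧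
    (∀ i j, φ j ∈ (P i).support → j = s i ∨ j = t i) ∧
    (∀ i j, i ≠ j → InternallyDisjoint (P i) (P j)) ∧
    H.verts = Set.range φ ∪ {v | ∃ i, v ∈ (P i).support} ∧
    H.edgeSet = {e | ∃ i, e ∈ (P i).edges}

/-- A (subdivision of a) circle: a cycle of `G`. -/
def IsCircle {V : Type u} {G : SimpleGraph V} (H : G.Subgraph) : Prop :=
  ∃ (x : V) (c : G.Walk x x), c.IsCycle ∧ H = c.toSubgraph

/-- A theta-curve: two vertices joined by three parallel edges. -/
def IsTheta {V : Type u} {G : SimpleGraph V} (H : G.Subgraph) : Prop :=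
  IsSubdivisionOf (n := 2) ![0, 0, 0] ![1, 1, 1] H

/-- A happy-face curve, i.e. a cycle graph of two circles and an arc: the circles are
`0 = 1` and `0 = 2` (two parallel edges each), they meet in `0`, and the arc is `1 - 2`. -/
def IsHappyFace {V : Type u} {G : SimpleGraph V} (H : G.Subgraph) : Prop :=
  IsSubdivisionOf (n := 3) ![0, 0, 0, 0, 1] ![1, 1, 2, 2, 2] H

/-- A baguette curve, i.e. a cycle graph of alternating two circles and two arcs: the circles
are `0 = 1` and `2 = 3` (two parallel edges each), the arcs are `0 - 2` and `1 - 3`. -/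
def IsBaguette {V : Type u} {G : SimpleGraph V} (H : G.Subgraph) : Prop :=
  IsSubdivisionOf (n := 4) ![0, 0, 2, 2, 0, 1] ![1, 1, 3, 3, 2, 3] H

/-- Basic `4`-ac subgraphs. -/
def IsBasicFourAC {V : Type u} {G : SimpleGraph V} (H : G.Subgraph) : Prop :=
  IsCircle H ∨ IsTheta H ∨ IsHappyFace H ∨ IsBaguette H

end ArcGraph

/-! The implications 1 → 2 → 3 → 1 are proved.

1 → 2: two points cut an arc into at most three pieces, so an arc meets at most three components of
the complement of two points (`IsArcConnected.not_cutsIntoAtLeast`).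

2 → 3 is graph theory once the topological condition has been turned into `NoFourCut` by
`noFourCut_of_not_cutsIntoAtLeast`. In a cyclically connected graph any two edges lie on a common
cycle, so every further edge lies on an ear, a path meeting the subgraph built so far in its two
ends only (`CyclicallyConnected.exists_ear`). Adding ears to a cycle through two of the edges puts
three of them on a cycle or on the three arms of a theta-curve with branch vertices `a`, `b`. If
they lie on a cycle, an ear through the fourth edge gives a theta-curve. On a theta-curve, an ear
with both ends on one arm gives a happy-face or a baguette curve (`inBasic_of_chord`), and an ear
between inner vertices of two arms gives a theta-curve after half an arm is dropped
(`inBasic_of_crossing`). The remaining ear joins `a` to `b` and produces four arms. Only here is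
`NoFourCut` needed: it supplies a path between two arms off `a` and `b`, after which some pieces can
be dropped (`inBasic_of_four_arms`).

3 → 1: at most four points lie on at most four edges, hence on a basic subgraph. The happy-face
curve has five arcs and the baguette curve six, so one arc is superfluous
(`exists_covered_without`), and what is left is a theta-curve, a figure eight or a dumbbell. In each
of these one follows an arc and prolongs it at both ends, stopping just short of points already
visited (`inArc_of_chain`).

The topology of the one-complex is controlled by the continuous functions `bumpFun`, which separate
its points and, for suitable parameters, the components of the complement of two vertices. -/

namespace ArcGraph

universe u

/-! ### Subdivisions assembled from paths -/

section Combinatorics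

variable {V : Type u} {G : SimpleGraph V}

open SimpleGraph

/-- The set of edges `F` is contained in a basic `4`-ac subgraph. -/
def InBasic (G : SimpleGraph V) (F : Set (Sym2 V)) : Prop :=
  ∃ H : G.Subgraph, IsBasicFourAC H ∧ F ⊆ H.edgeSet

lemma InternallyDisjoint.symm {a b c d : V} {P : G.Walk a b} {Q : G.Walk c d}
    (h : InternallyDisjoint P Q) : InternallyDisjoint Q P :=
  ⟨h.1.symm, fun z hQ hP => (h.2 z hP hQ).symm⟩

/-- By `hst` every branch vertex is an end of a path other than the `i`-th. Internal disjointness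
then forces a branch vertex on the `i`-th path to be one of its ends, and no branch vertex is
isolated, so the paths alone make up the subgraph. For the four concrete patterns `hst` is
decidable. -/
lemma isSubdivisionOf_iSup {n k : ℕ} [NeZero k] {s t : Fin k → Fin n} {φ : Fin n → V}
    (P : ∀ i : Fin k, G.Walk (φ (s i)) (φ (t i))) (hφ : Function.Injective φ)
    (hP : ∀ i, (P i).IsPath) (hd : ∀ i j, i < j → InternallyDisjoint (P i) (P j))
    (hst : ∀ (i : Fin k) (j : Fin n), ∃ i', i' ≠ i ∧ (j = s i' ∨ j = t i')) :
    IsSubdivisionOf s t (⨆ i, (P i).toSubgraph) := by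
  have hd' : ∀ i j, i ≠ j → InternallyDisjoint (P i) (P j) := fun i j hij =>
    hij.lt_or_gt.elim (hd i j) fun h => (hd j i h).symm
  refine ⟨φ, P, hφ, hP, fun i j hj => ?_, hd', ?_, ?_⟩
  · obtain ⟨i', hi', hj'⟩ := hst i j
    have hmem : φ j ∈ (P i').support := by
      rcases hj' with rfl | rfl <;> simp
    rcases ((hd' i' i hi').2 _ hmem hj).2 with h | h
    · exact .inl (hφ h)
    · exact .inr (hφ h)
  · ext v
    simp only [Subgraph.verts_iSup, Walk.verts_toSubgraph, Set.mem_iUnion, Set.mem_ofPred_eq,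
      Set.mem_union, Set.mem_range]
    refine ⟨.inr, ?_⟩
    rintro (⟨j, rfl⟩ | h)
    · obtain ⟨i', -, hj'⟩ := hst 0 j
      refine ⟨i', ?_⟩
      rcases hj' with rfl | rfl <;> simp
    · exact h
  · ext e
    simp

lemma inBasic_of_isCycle {F : Set (Sym2 V)} {x : V} {c : G.Walk x x} (hc : c.IsCycle)
    (hF : ∀ e ∈ F, e ∈ c.edges) : InBasic G F :=
  ⟨c.toSubgraph, .inl ⟨x, c, hc, rfl⟩, fun e he => by simpa using hF e he⟩

lemma inBasic_of_theta {F : Set (Sym2 V)} {a b : V} (hab : a ≠ b) {P Q R : G.Walk a b}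
    (hP : P.IsPath) (hQ : Q.IsPath) (hR : R.IsPath)
    (hPQ : InternallyDisjoint P Q) (hPR : InternallyDisjoint P R) (hQR : InternallyDisjoint Q R)
    (hF : ∀ e ∈ F, e ∈ P.edges ∨ e ∈ Q.edges ∨ e ∈ R.edges) : InBasic G F := by
  let W : ∀ i : Fin 3, G.Walk (![a, b] ((![0, 0, 0] : Fin 3 → Fin 2) i))
      (![a, b] ((![1, 1, 1] : Fin 3 → Fin 2) i)) :=
    fun i => match i with | 0 => P | 1 => Q | 2 => R
  refine ⟨⨆ i, (W i).toSubgraph, .inr (.inl (isSubdivisionOf_iSup W ?_ ?_ ?_ (by decide))), ?_⟩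
  · intro i j; fin_cases i <;> fin_cases j <;> simp [hab, hab.symm]
  · intro i; fin_cases i <;> assumption
  · intro i j h
    fin_cases i <;> fin_cases j <;> first | exact absurd h (by decide) | assumption
  · intro e he
    simpa [Fin.exists_fin_succ, W, or_assoc] using hF e he

lemma inBasic_of_happyFace {F : Set (Sym2 V)} {a b c : V} (hab : a ≠ b) (hac : a ≠ c) (hbc : b ≠ c)
    {P₁ P₂ : G.Walk a b} {Q₁ Q₂ : G.Walk a c} {R : G.Walk b c}
    (hP₁ : P₁.IsPath) (hP₂ : P₂.IsPath) (hQ₁ : Q₁.IsPath) (hQ₂ : Q₂.IsPath) (hR : R.IsPath)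
    (hPP : InternallyDisjoint P₁ P₂)
    (hPQ₁₁ : InternallyDisjoint P₁ Q₁) (hPQ₁₂ : InternallyDisjoint P₁ Q₂)
    (hPQ₂₁ : InternallyDisjoint P₂ Q₁) (hPQ₂₂ : InternallyDisjoint P₂ Q₂)
    (hPR₁ : InternallyDisjoint P₁ R) (hPR₂ : InternallyDisjoint P₂ R)
    (hQQ : InternallyDisjoint Q₁ Q₂)
    (hQR₁ : InternallyDisjoint Q₁ R) (hQR₂ : InternallyDisjoint Q₂ R)
    (hF : ∀ e ∈ F, e ∈ P₁.edges ∨ e ∈ P₂.edges ∨ e ∈ Q₁.edges ∨ e ∈ Q₂.edges ∨ e ∈ R.edges) :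
    InBasic G F := by
  let W : ∀ i : Fin 5, G.Walk (![a, b, c] ((![0, 0, 0, 0, 1] : Fin 5 → Fin 3) i))
      (![a, b, c] ((![1, 1, 2, 2, 2] : Fin 5 → Fin 3) i)) :=
    fun i => match i with | 0 => P₁ | 1 => P₂ | 2 => Q₁ | 3 => Q₂ | 4 => R
  refine ⟨⨆ i, (W i).toSubgraph,
    .inr (.inr (.inl (isSubdivisionOf_iSup W ?_ ?_ ?_ (by decide)))), ?_⟩
  · intro i j
    fin_cases i <;> fin_cases j <;> simp [hab, hab.symm, hac, hac.symm, hbc, hbc.symm]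
  · intro i; fin_cases i <;> assumption
  · intro i j h
    fin_cases i <;> fin_cases j <;> first | exact absurd h (by decide) | assumption
  · intro e he
    simpa [Fin.exists_fin_succ, W] using hF e he

lemma inBasic_of_baguette {F : Set (Sym2 V)} {a b c d : V} (hab : a ≠ b) (hac : a ≠ c)
    (had : a ≠ d) (hbc : b ≠ c) (hbd : b ≠ d) (hcd : c ≠ d)
    {P₁ P₂ : G.Walk a b} {Q₁ Q₂ : G.Walk c d} {R : G.Walk a c} {S : G.Walk b d}
    (hP₁ : P₁.IsPath) (hP₂ : P₂.IsPath) (hQ₁ : Q₁.IsPath) (hQ₂ : Q₂.IsPath) (hR : R.IsPath)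
    (hS : S.IsPath)
    (hPP : InternallyDisjoint P₁ P₂)
    (hPQ₁₁ : InternallyDisjoint P₁ Q₁) (hPQ₁₂ : InternallyDisjoint P₁ Q₂)
    (hPQ₂₁ : InternallyDisjoint P₂ Q₁) (hPQ₂₂ : InternallyDisjoint P₂ Q₂)
    (hPR₁ : InternallyDisjoint P₁ R) (hPR₂ : InternallyDisjoint P₂ R)
    (hPS₁ : InternallyDisjoint P₁ S) (hPS₂ : InternallyDisjoint P₂ S)
    (hQQ : InternallyDisjoint Q₁ Q₂)
    (hQR₁ : InternallyDisjoint Q₁ R) (hQR₂ : InternallyDisjoint Q₂ R)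
    (hQS₁ : InternallyDisjoint Q₁ S) (hQS₂ : InternallyDisjoint Q₂ S)
    (hRS : InternallyDisjoint R S)
    (hF : ∀ e ∈ F, e ∈ P₁.edges ∨ e ∈ P₂.edges ∨ e ∈ Q₁.edges ∨ e ∈ Q₂.edges ∨
      e ∈ R.edges ∨ e ∈ S.edges) :
    InBasic G F := by
  let W : ∀ i : Fin 6, G.Walk (![a, b, c, d] ((![0, 0, 2, 2, 0, 1] : Fin 6 → Fin 4) i))
      (![a, b, c, d] ((![1, 1, 3, 3, 2, 3] : Fin 6 → Fin 4) i)) :=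
    fun i => match i with | 0 => P₁ | 1 => P₂ | 2 => Q₁ | 3 => Q₂ | 4 => R | 5 => S
  refine ⟨⨆ i, (W i).toSubgraph,
    .inr (.inr (.inr (isSubdivisionOf_iSup W ?_ ?_ ?_ (by decide)))), ?_⟩
  · intro i j
    fin_cases i <;> fin_cases j <;> simp [hab, hab.symm, hac, hac.symm, hbc, hbc.symm, had,
      had.symm, hbd, hbd.symm, hcd, hcd.symm]
  · intro i; fin_cases i <;> assumption
  · intro i j h
    fin_cases i <;> fin_cases j <;> first | exact absurd h (by decide) | assumption
  · intro e he
    simpa [Fin.exists_fin_succ, W] using hF e he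

/-! ### Splitting and joining paths -/

lemma exists_split {a b u : V} {P : G.Walk a b} (hP : P.IsPath) (hu : u ∈ P.support) :
    ∃ (P₁ : G.Walk a u) (P₂ : G.Walk u b), P₁.IsPath ∧ P₂.IsPath ∧
      (∀ z, z ∈ P.support ↔ z ∈ P₁.support ∨ z ∈ P₂.support) ∧
      (∀ e, e ∈ P.edges ↔ e ∈ P₁.edges ∨ e ∈ P₂.edges) ∧
      (∀ z, z ∈ P₁.support → z ∈ P₂.support → z = u) ∧
      (∀ e, e ∈ P₁.edges → e ∈ P₂.edges → False) ∧ P₁.length + P₂.length = P.length := by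
  obtain ⟨P₁, P₂, rfl⟩ := Walk.mem_support_iff_exists_append.1 hu
  refine ⟨P₁, P₂, hP.of_append_left, hP.of_append_right, by simp, by simp, fun z h₁ h₂ => ?_,
    fun e h₁ h₂ => ?_, by simp⟩
  · by_contra hz
    exact hP.ne_of_mem_support_of_append hz h₁ h₂ rfl
  · exact (Walk.isTrail_append _ _).1 hP.isTrail |>.2.2 h₁ h₂

lemma isPath_append {a b c : V} {P : G.Walk a b} {Q : G.Walk b c} (hP : P.IsPath) (hQ : Q.IsPath)
    (h : ∀ z, z ∈ P.support → z ∈ Q.support → z = b) : (P.append Q).IsPath := by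
  induction P with
  | nil => simpa
  | cons hadj P ih =>
    rw [Walk.cons_isPath_iff] at hP
    rw [Walk.cons_append, Walk.cons_isPath_iff]
    refine ⟨ih hP.1 hQ fun z h₁ h₂ => h z (by simp [h₁]) h₂, ?_⟩
    rw [Walk.mem_support_append_iff]
    rintro (h' | h')
    · exact hP.2 h'
    · exact hP.2 ((h _ (by simp) h').symm ▸ Walk.end_mem_support P)

lemma ne_of_mem_edges {a b : V} {P : G.Walk a b} (hP : P.IsPath) {e : Sym2 V} (he : e ∈ P.edges) :
    a ≠ b := by
  rintro rfl
  rw [(Walk.isPath_iff_nil.1 hP).eq_nil] at he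
  simp at he

lemma mem_support_of_mem {a b : V} {P : G.Walk a b} {e : Sym2 V} (he : e ∈ P.edges) {z : V}
    (hz : z ∈ e) : z ∈ P.support := by
  induction e with
  | _ p q =>
    rcases Sym2.mem_iff.1 hz with rfl | rfl
    · exact P.fst_mem_support_of_mem_edges he
    · exact P.snd_mem_support_of_mem_edges he

/-- The only edge of a path between its end vertices is the whole path. -/
lemma eq_of_mem_edges_of_ends {a b : V} {P : G.Walk a b} (hP : P.IsPath) {e f : Sym2 V}
    (he : e ∈ P.edges) (hf : f ∈ P.edges) (h : ∀ z ∈ e, z = a ∨ z = b) : f = e := by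
  have hab : e = s(a, b) := by
    induction e with
    | _ p q =>
      have hpq := (P.adj_of_mem_edges he).ne
      have hp := h p (by simp)
      have hq := h q (by simp)
      rw [Sym2.eq_iff]
      grind
  subst hab
  have := hP.eq_adj_toWalk_of_mem_edges he
  rw [this] at hf
  simpa using hf

/-! ### Cycles and ears -/

lemma exists_isCycle_of_arms {a b : V} (hab : a ≠ b) {P Q : G.Walk a b} (hP : P.IsPath)
    (hQ : Q.IsPath) (h : InternallyDisjoint P Q) :
    (P.append Q.reverse).IsCycle := by
  refine hP.isCycle_append hQ.reverse ?_ ?_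
  · intro z hz hz'
    have h1 : z ∈ P.support := List.mem_of_mem_tail hz
    have h2 : z ∈ Q.support := by simpa using List.mem_of_mem_tail hz'
    rcases (h.2 z h1 h2).1 with rfl | rfl
    · have := hP.support_nodup
      rw [← Walk.cons_tail_support] at this
      exact (List.nodup_cons.1 this).1 hz
    · have := hQ.reverse.support_nodup
      rw [← Walk.cons_tail_support] at this
      exact (List.nodup_cons.1 this).1 hz'
  -- Two arms of length one would both be the edge `s(a, b)`; the condition on vertices does not
  -- exclude this, edge-disjointness does.
  · by_contra hlen
    push Not at hlen
    cases P with
    | nil => exact hab rfl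
    | cons h₁ P =>
      cases Q with
      | nil => exact hab rfl
      | cons h₂ Q =>
        cases P with
        | cons => simp at hlen
        | nil =>
          cases Q with
          | cons => simp at hlen
          | nil => exact h.1 (show s(a, b) ∈ _ by simp) (by simp)

/-- Rotate the cycle so that it starts at `u`, and cut it at `v`. -/
lemma exists_arms_of_isCycle {x : V} {c : G.Walk x x} (hc : c.IsCycle) {u v : V}
    (hu : u ∈ c.support) (hv : v ∈ c.support) (huv : u ≠ v) :
    ∃ P Q : G.Walk u v, P.IsPath ∧ Q.IsPath ∧ InternallyDisjoint P Q ∧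
      (∀ e, e ∈ c.edges ↔ e ∈ P.edges ∨ e ∈ Q.edges) ∧
      (∀ z, z ∈ c.support ↔ z ∈ P.support ∨ z ∈ Q.support) := by
  classical
  have hc' := (Walk.isCycle_rotate hu).2 hc
  have hsup : ∀ z, z ∈ (c.rotate u hu).support ↔ z ∈ c.support :=
    fun z => Walk.mem_support_rotate_iff c u hu
  have hedge : ∀ e, e ∈ (c.rotate u hu).edges ↔ e ∈ c.edges :=
    fun e => (Walk.rotate_edges c u hu).perm.mem_iff
  generalize c.rotate u hu = c' at hc' hsup hedge
  obtain ⟨A, B, rfl⟩ := Walk.mem_support_iff_exists_append.1 ((hsup v).2 hv)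
  have hA : A.IsPath := hc'.isPath_of_append_left (Walk.not_nil_of_ne huv.symm)
  have hB : B.IsPath := hc'.isPath_of_append_right (Walk.not_nil_of_ne huv)
  refine ⟨A, B.reverse, hA, hB.reverse, ⟨?_, ?_⟩, ?_, ?_⟩
  · have := ((Walk.isTrail_append _ _).1 hc'.isTrail).2.2
    intro e h₁ h₂
    exact this h₁ (by simpa using h₂)
  · intro z h₁ h₂
    have hnd := hc'.support_nodup
    rw [Walk.tail_support_append, List.nodup_append'] at hnd
    rw [Walk.support_reverse, List.mem_reverse] at h₂
    rw [← Walk.cons_tail_support] at h₁ h₂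
    rcases List.mem_cons.1 h₁ with rfl | h₁
    · simp
    rcases List.mem_cons.1 h₂ with rfl | h₂
    · simp
    exact (hnd.2.2 h₁ h₂).elim
  · intro e; rw [← hedge]; simp
  · intro z; rw [← hsup]; simp

/-- Of the two arms between the ends of the edge, the one containing the edge consists of it alone;
`D` is the other. -/
lemma exists_path_of_isCycle {x : V} {c : G.Walk x x} (hc : c.IsCycle) {p q : V}
    (he : s(p, q) ∈ c.edges) : ∃ D : G.Walk p q, D.IsPath ∧ s(p, q) ∉ D.edges ∧
      (∀ f, f ∈ c.edges ↔ f = s(p, q) ∨ f ∈ D.edges) := by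
  have hpq := (c.adj_of_mem_edges he).ne
  obtain ⟨A, B, hA, hB, hAB, hE, -⟩ := exists_arms_of_isCycle hc
    (c.fst_mem_support_of_mem_edges he) (c.snd_mem_support_of_mem_edges he) hpq
  have key : ∀ {X Y : G.Walk p q}, X.IsPath → Y.IsPath → InternallyDisjoint X Y →
      s(p, q) ∈ X.edges → s(p, q) ∉ Y.edges ∧
        ∀ f, f ∈ X.edges ∨ f ∈ Y.edges ↔ f = s(p, q) ∨ f ∈ Y.edges := by
    intro X Y hX hY hXY hm
    refine ⟨fun h => hXY.1 hm h, fun f => ?_⟩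
    have : f ∈ X.edges ↔ f = s(p, q) :=
      ⟨fun hf => eq_of_mem_edges_of_ends hX hm hf (by simp), fun h => h ▸ hm⟩
    rw [this]
  rcases (hE _).1 he with h | h
  · obtain ⟨h1, h2⟩ := key hA hB hAB h
    exact ⟨B, hB, h1, fun f => (hE f).trans (h2 f)⟩
  · obtain ⟨h1, h2⟩ := key hB hA hAB.symm h
    exact ⟨A, hA, h1, fun f => (hE f).trans (or_comm.trans (h2 f))⟩

/-- An edge `e` of a path with both ends in `S` lies on a subpath meeting `S` in its ends only. -/
lemma exists_ear_of_path (S : Set V) {e : Sym2 V} {p q : V} {P : G.Walk p q} (hP : P.IsPath)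
    (hp : p ∈ S) (hq : q ∈ S) (he : e ∈ P.edges) :
    ∃ (u v : V) (Q : G.Walk u v), Q.IsPath ∧ u ∈ S ∧ v ∈ S ∧ e ∈ Q.edges ∧
      ∀ z, z ∈ Q.support → z ∈ S → z = u ∨ z = v := by
  induction hn : P.length using Nat.strong_induction_on generalizing p q with
  | _ n ih =>
    by_cases h : ∀ z, z ∈ P.support → z ∈ S → z = p ∨ z = q
    · exact ⟨p, q, P, hP, hp, hq, he, h⟩
    · push Not at h
      obtain ⟨z, hz, hzS, hzp, hzq⟩ := h
      obtain ⟨A, B, hA, hB, -, hE, -, -, hlen⟩ := exists_split hP hz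
      have hA0 : A.length ≠ 0 := fun h => hzp (Walk.eq_of_length_eq_zero h).symm
      have hB0 : B.length ≠ 0 := fun h => hzq (Walk.eq_of_length_eq_zero h)
      rcases (hE e).1 he with h | h
      · exact ih A.length (by omega) hA hp hzS h rfl
      · exact ih B.length (by omega) hB hzS hq h rfl

/-- A path from `A` to `B` contains a subpath from `A` to `B` meeting `A` and `B` in its ends
only. -/
lemma exists_subpath_between (A B : Set V) {p q : V} {P : G.Walk p q} (hP : P.IsPath)
    (hp : p ∈ A) (hq : q ∈ B) :
    ∃ (u v : V) (Q : G.Walk u v), Q.IsPath ∧ u ∈ A ∧ v ∈ B ∧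
      (∀ z, z ∈ Q.support → z ∈ P.support) ∧
      ∀ z, z ∈ Q.support → (z ∈ A → z = u) ∧ (z ∈ B → z = v) := by
  induction hn : P.length using Nat.strong_induction_on generalizing p q with
  | _ n ih =>
    by_cases h : ∀ z, z ∈ P.support → (z ∈ A → z = p) ∧ (z ∈ B → z = q)
    · exact ⟨p, q, P, hP, hp, hq, fun _ => id, h⟩
    · push Not at h
      obtain ⟨z, hz, hzS⟩ := h
      obtain ⟨X, Y, hX, hY, hXY, -, -, -, hlen⟩ := exists_split hP hz
      by_cases hzA : z ∈ A ∧ z ≠ p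
      · have hX0 : X.length ≠ 0 := fun h => hzA.2 (Walk.eq_of_length_eq_zero h).symm
        obtain ⟨u, v, Q, h1, h2, h3, h4, h5⟩ := ih Y.length (by omega) hY hzA.1 hq rfl
        exact ⟨u, v, Q, h1, h2, h3, fun z hz => (hXY z).2 (.inr (h4 z hz)), h5⟩
      · obtain ⟨hzB, hzq⟩ := hzS (by tauto)
        have hY0 : Y.length ≠ 0 := fun h => hzq (Walk.eq_of_length_eq_zero h)
        obtain ⟨u, v, Q, h1, h2, h3, h4, h5⟩ := ih X.length (by omega) hX hp hzB rfl
        exact ⟨u, v, Q, h1, h2, h3, fun z hz => (hXY z).2 (.inl (h4 z hz)), h5⟩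

/-! ### Any two edges of a cyclically connected graph lie on a common cycle -/

/-- Two edges lie on a common cycle. -/
def OnCommonCycle (G : SimpleGraph V) (e f : Sym2 V) : Prop :=
  ∃ (x : V) (c : G.Walk x x), c.IsCycle ∧ e ∈ c.edges ∧ f ∈ c.edges

lemma OnCommonCycle.symm {e f : Sym2 V} (h : OnCommonCycle G e f) : OnCommonCycle G f e := by
  obtain ⟨x, c, hc, he, hf⟩ := h
  exact ⟨x, c, hc, hf, he⟩

lemma onCommonCycle_of_arms {a b : V} (hab : a ≠ b) {P Q : G.Walk a b} (hP : P.IsPath)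
    (hQ : Q.IsPath) (h : InternallyDisjoint P Q) {e f : Sym2 V}
    (he : e ∈ P.edges ∨ e ∈ Q.edges) (hf : f ∈ P.edges ∨ f ∈ Q.edges) : OnCommonCycle G e f :=
  ⟨a, _, exists_isCycle_of_arms hab hP hQ h, by simpa using he, by simpa using hf⟩

/-- A path that meets `S` in its ends only, and contains an edge `e`, shares no edge with a path
inside `S` that avoids `e`. -/
lemma disjoint_edges_of_ear {S : Set V} {u v a b : V} {Q : G.Walk u v} (hQ : Q.IsPath)
    {e : Sym2 V} (he : e ∈ Q.edges) (hQS : ∀ z, z ∈ Q.support → z ∈ S → z = u ∨ z = v)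
    {P : G.Walk a b} (hPS : ∀ z ∈ P.support, z ∈ S) (hP : e ∉ P.edges) :
    P.edges.Disjoint Q.edges := by
  intro g hgP hgQ
  -- A common edge has both ends in `S`, so it joins the ends of `Q`; then it is all of `Q`, in
  -- particular equal to `e`.
  have := eq_of_mem_edges_of_ends hQ hgQ he fun z hz =>
    hQS z (mem_support_of_mem hgQ hz) (hPS z (mem_support_of_mem hgP hz))
  exact hP (this ▸ hgP)

/-- The second cycle without `f` is a path with both ends on the first cycle. If `g` is not on the
first cycle, this path contains an ear of it through `g`; the ear closes up with the arm of the
first cycle that carries `e`. -/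
lemma OnCommonCycle.trans {e f g : Sym2 V} (h₁ : OnCommonCycle G e f) (h₂ : OnCommonCycle G f g) :
    OnCommonCycle G e g := by
  obtain ⟨x, c, hc, he, hf⟩ := h₁
  obtain ⟨y, c', hc', hf', hg⟩ := h₂
  by_cases hgc : g ∈ c.edges
  · exact ⟨x, c, hc, he, hgc⟩
  induction f with
  | _ p q =>
    obtain ⟨D, hD, -, hE⟩ := exists_path_of_isCycle hc' hf'
    have hgD : g ∈ D.edges := ((hE g).1 hg).resolve_left (by rintro rfl; exact hgc hf)
    obtain ⟨u, v, Q, hQ, hu, hv, hgQ, hQS⟩ := exists_ear_of_path {z | z ∈ c.support} hD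
      (c.fst_mem_support_of_mem_edges hf) (c.snd_mem_support_of_mem_edges hf) hgD
    have huv := ne_of_mem_edges hQ hgQ
    obtain ⟨A, B, hA, hB, hAB, hcE, hcS⟩ := exists_arms_of_isCycle hc hu hv huv
    rcases (hcE e).1 he with h | h
    · refine onCommonCycle_of_arms huv hA hQ ⟨disjoint_edges_of_ear hQ hgQ hQS
        (fun z hz => (hcS z).2 (.inl hz)) (fun h => hgc ((hcE g).2 (.inl h))), fun z h₁ h₂ => ?_⟩
        (.inl h) (.inr hgQ)
      exact ⟨hQS z h₂ ((hcS z).2 (.inl h₁)), hQS z h₂ ((hcS z).2 (.inl h₁))⟩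
    · refine onCommonCycle_of_arms huv hB hQ ⟨disjoint_edges_of_ear hQ hgQ hQS
        (fun z hz => (hcS z).2 (.inr hz)) (fun h => hgc ((hcE g).2 (.inr h))), fun z h₁ h₂ => ?_⟩
        (.inl h) (.inr hgQ)
      exact ⟨hQS z h₂ ((hcS z).2 (.inr h₁)), hQS z h₂ ((hcS z).2 (.inr h₁))⟩

/-- A cycle through `u` and `w` has two arms between them, and `v` lies on at most one. The other
arm closes up through `v`. -/
lemma CyclicallyConnected.onCommonCycle_of_adj (hG : CyclicallyConnected G) {v u w : V}
    (hu : G.Adj v u) (hw : G.Adj v w) (huw : u ≠ w) :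
    OnCommonCycle G s(v, u) s(v, w) := by
  obtain ⟨x, c, hc, huc, hwc⟩ := hG u w
  obtain ⟨A, B, hA, hB, hAB, -, -⟩ := exists_arms_of_isCycle hc huc hwc huw
  have key : ∀ X : G.Walk u w, X.IsPath → v ∉ X.support → OnCommonCycle G s(v, u) s(v, w) := by
    intro X hX hv
    refine onCommonCycle_of_arms hw.ne (P := .cons hu X) (Q := hw.toWalk) (hX.cons hv)
      hw.isPath_toWalk ⟨?_, ?_⟩ (.inl (by simp)) (.inr (by simp))
    · intro e h₁ h₂
      simp only [Walk.edges_cons, Walk.edges_nil, List.mem_cons, List.not_mem_nil,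
        or_false] at h₁ h₂
      subst h₂
      rcases h₁ with h | h
      · rw [Sym2.eq_iff] at h
        have := hw.ne
        grind
      · exact hv (Walk.fst_mem_support_of_mem_edges _ h)
    · intro z _ h
      have : z = v ∨ z = w := by simpa using h
      exact ⟨this, this⟩
  by_cases hv : v ∈ A.support
  · refine key B hB fun hvB => ?_
    rcases (hAB.2 v hv hvB).1 with h | h
    · exact hu.ne h
    · exact hw.ne h
  · exact key A hA hv

/-- Adjacent distinct edges are related, so transitivity carries the relation along a walk from `e`
to `f`. Equality is kept as a separate alternative, since reflexivity is only obtained at the end.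
-/
lemma CyclicallyConnected.onCommonCycle (hG : CyclicallyConnected G) {e f : Sym2 V}
    (he : e ∈ G.edgeSet) (hf : f ∈ G.edgeSet) : OnCommonCycle G e f := by
  have key : ∀ {x y : V} (W : G.Walk x y) (z : V), G.Adj x z →
      (s(x, z) = e ∨ OnCommonCycle G e s(x, z)) → ∀ w, G.Adj y w →
      (s(y, w) = e ∨ OnCommonCycle G e s(y, w)) := by
    have step : ∀ (x z : V), G.Adj x z → (s(x, z) = e ∨ OnCommonCycle G e s(x, z)) →
        ∀ w, G.Adj x w → (s(x, w) = e ∨ OnCommonCycle G e s(x, w)) := by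
      intro x z hz h w hw
      by_cases hzw : z = w
      · exact hzw ▸ h
      · have h' := hG.onCommonCycle_of_adj hz hw hzw
        rcases h with h | h
        · exact .inr (h ▸ h')
        · exact .inr (h.trans h')
    intro x y W
    induction W with
    | nil => exact fun z => step _ z
    | @cons x x' y hadj W ih =>
      intro z hz h
      refine ih x hadj.symm ?_
      rw [Sym2.eq_swap]
      exact step x z hz h x' hadj
  have hdist : ∀ f ∈ G.edgeSet, f = e ∨ OnCommonCycle G e f := by
    intro f hf
    induction e with
    | _ x z =>
      induction f with
      | _ y w =>
        obtain ⟨t, c, -, hx, hy⟩ := hG x y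
        obtain ⟨W₁, -, -⟩ := Walk.mem_support_iff_exists_append.1 hx
        obtain ⟨W₂, -, -⟩ := Walk.mem_support_iff_exists_append.1 hy
        exact key (W₁.reverse.append W₂) z he (.inl rfl) w hf
  rcases hdist f hf with rfl | h
  · induction f with
    | _ p q =>
      obtain ⟨x, c, hc, hp, hq⟩ := hG p q
      have hl := hc.three_le_length
      -- The cycle through `p` and `q` need not use the edge between them. Any other edge `g`
      -- suffices: reflexivity follows from symmetry and transitivity.
      obtain ⟨g, hg, hne⟩ : ∃ g ∈ c.edges, g ≠ s(p, q) := by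
        by_contra! h
        have h1 := List.eq_replicate_of_mem h
        have h2 := hc.isTrail.edges_nodup
        rw [h1, List.nodup_replicate, Walk.length_edges] at h2
        omega
      have := (hdist g (Walk.edges_subset_edgeSet c hg)).resolve_left hne
      exact this.trans this.symm
  · exact h

/-- If `S` contains the ends of an edge `f ≠ e` then there is a path containing `e` that has its
(distinct) ends, but no other vertices, in `S`. -/
lemma CyclicallyConnected.exists_ear (hG : CyclicallyConnected G) (S : Set V) {e f : Sym2 V}
    (he : e ∈ G.edgeSet) (hf : f ∈ G.edgeSet) (hef : e ≠ f) (hfS : ∀ z ∈ f, z ∈ S) :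
    ∃ (u v : V) (Q : G.Walk u v), Q.IsPath ∧ u ∈ S ∧ v ∈ S ∧ e ∈ Q.edges ∧
      ∀ z, z ∈ Q.support → z ∈ S → z = u ∨ z = v := by
  obtain ⟨x, c, hc, hec, hfc⟩ := hG.onCommonCycle he hf
  induction f with
  | _ p q =>
    obtain ⟨D, hD, -, hE⟩ := exists_path_of_isCycle hc hfc
    exact exists_ear_of_path S hD (hfS p (by simp)) (hfS q (by simp))
      (((hE e).1 hec).resolve_left hef)

/-! ### Attaching paths to theta-curves -/

lemma internallyDisjoint_of_forall_eq {a b c d w : V} {P : G.Walk a b} {Q : G.Walk c d}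
    (h : ∀ z, z ∈ P.support → z ∈ Q.support → z = w)
    (hw : (w = a ∨ w = b) ∧ (w = c ∨ w = d)) : InternallyDisjoint P Q := by
  refine ⟨fun e hP hQ => ?_, fun z h₁ h₂ => h z h₁ h₂ ▸ hw⟩
  induction e with
  | _ p q =>
    refine (P.adj_of_mem_edges hP).ne ?_
    rw [h p (P.fst_mem_support_of_mem_edges hP) (Q.fst_mem_support_of_mem_edges hQ),
      h q (P.snd_mem_support_of_mem_edges hP) (Q.snd_mem_support_of_mem_edges hQ)]

lemma internallyDisjoint_of_forall_not {a b c d : V} {P : G.Walk a b} {Q : G.Walk c d}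
    (h : ∀ z, z ∈ P.support → z ∈ Q.support → False) : InternallyDisjoint P Q := by
  refine ⟨fun e hP hQ => ?_, fun z h₁ h₂ => (h z h₁ h₂).elim⟩
  induction e with
  | _ p q => exact h p (P.fst_mem_support_of_mem_edges hP) (Q.fst_mem_support_of_mem_edges hQ)

lemma InternallyDisjoint.reverse_left {a b c d : V} {P : G.Walk a b} {Q : G.Walk c d}
    (h : InternallyDisjoint P Q) : InternallyDisjoint P.reverse Q := by
  refine ⟨fun e h₁ h₂ => h.1 (by simpa using h₁) h₂, fun z h₁ h₂ => ?_⟩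
  have := h.2 z (by simpa using h₁) h₂
  tauto

lemma InternallyDisjoint.reverse_right {a b c d : V} {P : G.Walk a b} {Q : G.Walk c d}
    (h : InternallyDisjoint P Q) : InternallyDisjoint P Q.reverse :=
  h.symm.reverse_left.symm

/-- A family of internally disjoint paths between two distinct vertices. -/
structure Arms {k : ℕ} {a b : V} (P : Fin k → G.Walk a b) : Prop where
  ne : a ≠ b
  isPath : ∀ i, (P i).IsPath
  disj : ∀ i j, i ≠ j → InternallyDisjoint (P i) (P j)

lemma inBasic_of_arms {F : Set (Sym2 V)} {a b : V} {P : Fin 3 → G.Walk a b} (h : Arms P)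
    (hF : ∀ e ∈ F, ∃ i, e ∈ (P i).edges) : InBasic G F :=
  inBasic_of_theta h.ne (h.isPath 0) (h.isPath 1) (h.isPath 2) (h.disj _ _ (by decide))
    (h.disj _ _ (by decide)) (h.disj _ _ (by decide))
    (by simpa [Fin.exists_fin_succ, or_assoc] using hF)

set_option maxHeartbeats 1000000 in
/-- A path attached to a single arm of a theta-curve. -/
lemma inBasic_of_chord {F : Set (Sym2 V)} {a b u v : V} {P P₁ P₂ : G.Walk a b} {Q : G.Walk u v}
    (hab : a ≠ b) (hP : P.IsPath) (hP₁ : P₁.IsPath) (hP₂ : P₂.IsPath) (hQ : Q.IsPath)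
    (h₁ : InternallyDisjoint P P₁) (h₂ : InternallyDisjoint P P₂)
    (h₁₂ : InternallyDisjoint P₁ P₂) (hu : u ∈ P.support) (hv : v ∈ P.support) (huv : u ≠ v)
    (hne : ¬ (u = a ∧ v = b)) (hne' : ¬ (u = b ∧ v = a))
    (hQP : P.edges.Disjoint Q.edges) (hQP₁ : P₁.edges.Disjoint Q.edges)
    (hQP₂ : P₂.edges.Disjoint Q.edges)
    (hQ' : ∀ z, z ∈ Q.support → z ∈ P.support ∨ z ∈ P₁.support ∨ z ∈ P₂.support → z = u ∨ z = v)
    (hF : ∀ e ∈ F, e ∈ P.edges ∨ e ∈ P₁.edges ∨ e ∈ P₂.edges ∨ e ∈ Q.edges) : InBasic G F := by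
  obtain ⟨A, P', hA, hP', hPs, hPe, hAP, hAPe, -⟩ := exists_split hP hu
  -- Reversing all three arms, `u` may be assumed to precede `v` on `P`, which becomes `A`, `M`, `B`
  -- in this order.
  wlog hvP : v ∈ P'.support generalizing a b
  · have hvA : v ∈ A.support := ((hPs v).1 hv).resolve_right hvP
    exact this hab.symm hP.reverse hP₁.reverse hP₂.reverse h₁.reverse_left.reverse_right
      h₂.reverse_left.reverse_right h₁₂.reverse_left.reverse_right (by simpa) (by simpa)
      (by tauto) (by tauto) (by simpa) (by simpa) (by simpa) (by simpa using hQ') (by simpa using hF)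
      P'.reverse A.reverse hP'.reverse hA.reverse (by simpa [or_comm] using hPs)
      (by simpa [or_comm] using hPe) (fun z h h' => hAP z (by simpa using h') (by simpa using h))
      (fun z h h' => hAPe z (by simpa using h') (by simpa using h)) (by simpa)
  obtain ⟨M, B, hM, hB, hPs', hPe', hMB, hMBe, -⟩ := exists_split hP' hvP
  obtain ⟨h₁e, h₁s⟩ := h₁
  obtain ⟨h₂e, h₂s⟩ := h₂
  have hu₁ := M.start_mem_support
  have hv₁ := B.start_mem_support
  have ha := A.start_mem_support
  have hb := B.end_mem_support
  have hA₀ : ∀ e, e ∈ A.edges → a ≠ u := fun e => ne_of_mem_edges hA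
  have hB₀ : ∀ e, e ∈ B.edges → v ≠ b := fun e => ne_of_mem_edges hB
  have hub : u ≠ b := fun h => huv (h.trans (hMB _ (h ▸ hu₁) hb))
  have hva : v ≠ a := fun h => huv (h.trans (hAP _ ha (h ▸ hvP))).symm
  have h₁₂' := h₁₂
  obtain ⟨h₁₂e, h₁₂s⟩ := h₁₂'
  clear hu hv hP hP'
  have hMQ : InternallyDisjoint M Q :=
    ⟨fun e he he' => hQP ((hPe e).2 (.inr ((hPe' e).2 (.inl he)))) he', fun z hz hz' =>
      have := hQ' z hz' (.inl ((hPs z).2 (.inr ((hPs' z).2 (.inl hz)))))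
      ⟨this, this⟩⟩
  unfold List.Disjoint at h₁e h₂e hQP hQP₁ hQP₂
  -- One circle is formed by `M` and `Q`, the other by `P₁` and `P₂`, and `A` and `B` link them. If
  -- one link is trivial the curve is a happy face, otherwise a baguette; both being trivial is
  -- excluded by `hne`.
  by_cases hua : u = a
  · subst hua
    have hvb : v ≠ b := by tauto
    refine inBasic_of_happyFace (F := F) (P₁ := M) (P₂ := Q) (Q₁ := P₁) (Q₂ := P₂) (R := B) huv hab
      hvb hM hQ hP₁ hP₂ hB hMQ ?_ ?_ ?_ ?_ ?_ ?_ h₁₂ ?_ ?_ ?_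
    on_goal 9 => exact fun e he => by grind only
    all_goals
      clear hF
      exact ⟨fun e he he' => by
          clear * - h₁e h₂e hPe hPe' hAPe hMBe hQP hQP₁ hQP₂ he he'; grind only,
        fun z hz hz' => by
          clear hMQ hPe hPe' hAPe hMBe h₁e h₂e hQP hQP₁ hQP₂; grind only⟩
  by_cases hvb : v = b
  · subst hvb
    refine inBasic_of_happyFace (F := F) (P₁ := M.reverse) (P₂ := Q.reverse) (Q₁ := P₁.reverse)
      (Q₂ := P₂.reverse) (R := A.reverse) huv.symm hab.symm hua hM.reverse hQ.reverse hP₁.reverse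
      hP₂.reverse hA.reverse hMQ.reverse_left.reverse_right ?_ ?_ ?_ ?_ ?_ ?_
      h₁₂.reverse_left.reverse_right ?_ ?_ ?_
    on_goal 9 => exact fun e he => by simp only [Walk.edges_reverse, List.mem_reverse]; grind only
    all_goals
      clear hF
      simp only [InternallyDisjoint, List.Disjoint, Walk.support_reverse, Walk.edges_reverse,
        List.mem_reverse]
      exact ⟨fun e he he' => by
          clear * - h₁e h₂e hPe hPe' hAPe hMBe hQP hQP₁ hQP₂ he he'; grind only,
        fun z hz hz' => by
          clear hMQ hPe hPe' hAPe hMBe h₁e h₂e hQP hQP₁ hQP₂; grind only⟩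
  · refine inBasic_of_baguette (F := F) (P₁ := M) (P₂ := Q) (Q₁ := P₁) (Q₂ := P₂) (R := A.reverse)
      (S := B) huv hua hub hva hvb hab hM hQ hP₁ hP₂ hA.reverse hB hMQ ?_ ?_ ?_ ?_ ?_ ?_ ?_ ?_ h₁₂
      ?_ ?_ ?_ ?_ ?_ ?_
    on_goal 14 => exact fun e he => by simp only [Walk.edges_reverse, List.mem_reverse]; grind only
    all_goals
      clear hF
      simp only [InternallyDisjoint, List.Disjoint, Walk.support_reverse, Walk.edges_reverse,
        List.mem_reverse]
      exact ⟨fun e he he' => by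
          clear * - h₁e h₂e hPe hPe' hAPe hMBe hQP hQP₁ hQP₂ he he'; grind only,
        fun z hz hz' => by
          clear hMQ hPe hPe' hAPe hMBe h₁e h₂e hQP hQP₁ hQP₂; grind only⟩

/-- A theta-curve with branch vertices `a` and `v`: one arm is the part of `P₂` before `v`, one runs
along `A` and `Q`, and one runs along `P₃` and back over the rest of `P₂`. -/
lemma inBasic_of_crossing_aux {F : Set (Sym2 V)} {a b u v : V} {A : G.Walk a u}
    {P₂ P₃ : G.Walk a b} {Q : G.Walk u v} (hva : v ≠ a) (hvb : v ≠ b)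
    (hA : A.IsPath) (hP₂ : P₂.IsPath) (hP₃ : P₃.IsPath) (hQ : Q.IsPath)
    (hA₂ : ∀ z, z ∈ A.support → z ∈ P₂.support → z = a)
    (hA₃ : ∀ z, z ∈ A.support → z ∈ P₃.support → z = a)
    (hAQ : ∀ z, z ∈ A.support → z ∈ Q.support → z = u)
    (hQ₂ : ∀ z, z ∈ Q.support → z ∈ P₂.support → z = v)
    (hQ₃ : ∀ z, z ∈ Q.support → z ∈ P₃.support → False)
    (h₂₃ : InternallyDisjoint P₂ P₃) (hv : v ∈ P₂.support)
    (hF : ∀ e ∈ F, e ∈ A.edges ∨ e ∈ P₂.edges ∨ e ∈ P₃.edges ∨ e ∈ Q.edges) :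
    InBasic G F := by
  obtain ⟨X, Y, hX, hY, hs, he, hXY, hXYe, -⟩ := exists_split hP₂ hv
  obtain ⟨h₂₃e, h₂₃s⟩ := h₂₃
  have ha := X.start_mem_support
  have hb := Y.end_mem_support
  have hvX := X.end_mem_support
  have hvY := Y.start_mem_support
  have hYa : a ∉ Y.support := fun h => hva (hXY a ha h).symm
  have hXb : b ∉ X.support := fun h => hvb (hXY b h hb).symm
  have h₃Y : ∀ z, z ∈ P₃.support → z ∈ Y.support → z = b := fun z h h' =>
    ((h₂₃s z ((hs z).2 (.inr h')) h).1).resolve_left fun h'' => hYa (h'' ▸ h')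
  have hX₃ : ∀ z, z ∈ X.support → z ∈ P₃.support → z = a := fun z h h' =>
    ((h₂₃s z ((hs z).2 (.inl h)) h').1).resolve_right fun h'' => hXb (h'' ▸ h)
  have hAQp := isPath_append hA hQ hAQ
  have h₃Yp : (P₃.append Y.reverse).IsPath :=
    isPath_append hP₃ hY.reverse (fun z h h' => h₃Y z h (by simpa using h'))
  unfold List.Disjoint at h₂₃e
  have hX_AQ : ∀ z, z ∈ X.support → z ∈ (A.append Q).support → z = a ∨ z = v := by
    intro z h h'
    rw [Walk.mem_support_append_iff] at h'
    rcases h' with h' | h'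
    · exact .inl (hA₂ z h' ((hs z).2 (.inl h)))
    · exact .inr (hQ₂ z h' ((hs z).2 (.inl h)))
  have hX_3Y : ∀ z, z ∈ X.support → z ∈ (P₃.append Y.reverse).support → z = a ∨ z = v := by
    intro z h h'
    rw [Walk.mem_support_append_iff, Walk.support_reverse, List.mem_reverse] at h'
    rcases h' with h' | h'
    · exact .inl (hX₃ z h h')
    · exact .inr (hXY z h h')
  have hAQ_3Y : ∀ z, z ∈ (A.append Q).support → z ∈ (P₃.append Y.reverse).support →
      z = a ∨ z = v := by
    intro z h h'
    rw [Walk.mem_support_append_iff, Walk.support_reverse, List.mem_reverse] at h'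
    rw [Walk.mem_support_append_iff] at h
    rcases h with h | h <;> rcases h' with h' | h'
    · exact .inl (hA₃ z h h')
    · exact .inl (hA₂ z h ((hs z).2 (.inr h')))
    · exact (hQ₃ z h h').elim
    · exact .inr (hQ₂ z h ((hs z).2 (.inr h')))
  have hAX : A.edges.Disjoint P₂.edges := (internallyDisjoint_of_forall_eq hA₂ (by simp)).1
  have hA₃e : A.edges.Disjoint P₃.edges := (internallyDisjoint_of_forall_eq hA₃ (by simp)).1
  have hQ₂e : Q.edges.Disjoint P₂.edges := by
    intro e h h'
    induction e with
    | _ p q =>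
      refine (Q.adj_of_mem_edges h).ne ?_
      rw [hQ₂ p (Q.fst_mem_support_of_mem_edges h) (P₂.fst_mem_support_of_mem_edges h'),
        hQ₂ q (Q.snd_mem_support_of_mem_edges h) (P₂.snd_mem_support_of_mem_edges h')]
  have hQ₃e : Q.edges.Disjoint P₃.edges := (internallyDisjoint_of_forall_not hQ₃).1
  refine inBasic_of_theta (P := X) (Q := A.append Q) (R := P₃.append Y.reverse) hva.symm hX hAQp
    h₃Yp ⟨?_, fun z h h' => ⟨hX_AQ z h h', hX_AQ z h h'⟩⟩
    ⟨?_, fun z h h' => ⟨hX_3Y z h h', hX_3Y z h h'⟩⟩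
    ⟨?_, fun z h h' => ⟨hAQ_3Y z h h', hAQ_3Y z h h'⟩⟩ ?_
  all_goals
    unfold List.Disjoint at *
    simp only [Walk.edges_append, Walk.edges_reverse, List.mem_append, List.mem_reverse]
    clear * - h₂₃e he hXYe hAX hA₃e hQ₂e hQ₃e hF
    grind only

/-- A path joining inner vertices of two arms of a theta-curve. -/
lemma inBasic_of_crossing {F : Set (Sym2 V)} {a b u v : V} {P₁ P₂ P₃ : G.Walk a b}
    {Q : G.Walk u v} (hab : a ≠ b) (hP₁ : P₁.IsPath) (hP₂ : P₂.IsPath) (hP₃ : P₃.IsPath)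
    (hQ : Q.IsPath)
    (h₁₂ : InternallyDisjoint P₁ P₂) (h₁₃ : InternallyDisjoint P₁ P₃)
    (h₂₃ : InternallyDisjoint P₂ P₃) (hu : u ∈ P₁.support) (hv : v ∈ P₂.support)
    (hua : u ≠ a) (hub : u ≠ b) (hva : v ≠ a) (hvb : v ≠ b)
    (hQ' : ∀ z, z ∈ Q.support → z ∈ P₁.support ∨ z ∈ P₂.support ∨ z ∈ P₃.support → z = u ∨ z = v)
    {e₁ : Sym2 V} (he₁ : e₁ ∈ P₁.edges)
    (hF : ∀ e ∈ F, e = e₁ ∨ e ∈ P₂.edges ∨ e ∈ P₃.edges ∨ e ∈ Q.edges) : InBasic G F := by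
  obtain ⟨A, B, hA, hB, hs, he, hAB, -, -⟩ := exists_split hP₁ hu
  -- Only the edge `e₁` of `P₁` must be kept, so the half of `P₁` without it is dropped; by symmetry
  -- this is the half at `b`.
  wlog hm : e₁ ∈ A.edges generalizing a b
  · have hmB : e₁ ∈ B.edges := ((he e₁).1 he₁).resolve_left hm
    exact this hab.symm hP₁.reverse hP₂.reverse hP₃.reverse h₁₂.reverse_left.reverse_right
      h₁₃.reverse_left.reverse_right h₂₃.reverse_left.reverse_right (by simpa) (by simpa)
      hub hua hvb hva (by simpa using hQ') (by simpa) (by simpa using hF) B.reverse A.reverse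
      hB.reverse hA.reverse (by simpa [or_comm] using hs)
      (by simpa [or_comm] using he) (fun z h h' => hAB z (by simpa using h') (by simpa using h))
      (by simpa)
  have hbA : b ∉ A.support := fun h => hub (hAB b h B.end_mem_support).symm
  have hA' : ∀ z, z ∈ A.support → z = a ∨ z = b → z = a := fun z h h' =>
    h'.resolve_right fun h'' => hbA (h'' ▸ h)
  have hAs : ∀ z, z ∈ A.support → z ∈ P₁.support := fun z h => (hs z).2 (.inl h)
  have hu₂ : u ∉ P₂.support := fun h => by have := h₁₂.2 u hu h; tauto
  have hu₃ : u ∉ P₃.support := fun h => by have := h₁₃.2 u hu h; tauto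
  have hv₁ : v ∉ P₁.support := fun h => by have := h₁₂.2 v h hv; tauto
  have hv₃ : v ∉ P₃.support := fun h => by have := h₂₃.2 v hv h; tauto
  refine inBasic_of_crossing_aux (A := A) (P₂ := P₂) (P₃ := P₃) (Q := Q) hva hvb hA hP₂ hP₃ hQ
    (fun z h h' => hA' z h (h₁₂.2 z (hAs z h) h').1)
    (fun z h h' => hA' z h (h₁₃.2 z (hAs z h) h').1)
    (fun z h h' => (hQ' z h' (.inl (hAs z h))).resolve_right fun h'' => hv₁ (h'' ▸ hAs z h))
    (fun z h h' => (hQ' z h (.inr (.inl h'))).resolve_left fun h'' => hu₂ (h'' ▸ h'))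
    (fun z h h' => (hQ' z h (.inr (.inr h'))).elim (fun h'' => hu₃ (h'' ▸ h'))
      (fun h'' => hv₃ (h'' ▸ h'))) h₂₃ hv ?_
  intro e h
  rcases hF e h with rfl | h
  · exact .inl hm
  · exact .inr h

/-- A path joining inner vertices of two out of four arms. -/
lemma inBasic_of_four_arms_aux {F : Set (Sym2 V)} {a b u v : V} {P₁ P₂ P₃ P₄ : G.Walk a b}
    {R : G.Walk u v} (hab : a ≠ b) (hP₁ : P₁.IsPath) (hP₂ : P₂.IsPath) (hP₃ : P₃.IsPath)
    (hP₄ : P₄.IsPath) (hR : R.IsPath)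
    (h₁₂ : InternallyDisjoint P₁ P₂) (h₁₃ : InternallyDisjoint P₁ P₃)
    (h₁₄ : InternallyDisjoint P₁ P₄) (h₂₃ : InternallyDisjoint P₂ P₃)
    (h₂₄ : InternallyDisjoint P₂ P₄) (h₃₄ : InternallyDisjoint P₃ P₄)
    (hu : u ∈ P₁.support) (hv : v ∈ P₂.support)
    (hua : u ≠ a) (hub : u ≠ b) (hva : v ≠ a) (hvb : v ≠ b)
    (hR₁ : ∀ z, z ∈ R.support → z ∈ P₁.support → z = u)
    (hR₂ : ∀ z, z ∈ R.support → z ∈ P₂.support → z = v)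
    (hR₃ : ∀ z, z ∈ R.support → z ∈ P₃.support → False)
    (hR₄ : ∀ z, z ∈ R.support → z ∈ P₄.support → False)
    {e₁ e₂ : Sym2 V} (he₁ : e₁ ∈ P₁.edges) (he₂ : e₂ ∈ P₂.edges)
    (hF : ∀ e ∈ F, e = e₁ ∨ e = e₂ ∨ e ∈ P₃.edges ∨ e ∈ P₄.edges) : InBasic G F := by
  obtain ⟨A, B, hA, hB, hs, he, hAB, -, -⟩ := exists_split hP₁ hu
  wlog hm : e₁ ∈ A.edges generalizing a b
  · have hmB : e₁ ∈ B.edges := ((he e₁).1 he₁).resolve_left hm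
    exact this hab.symm hP₁.reverse hP₂.reverse hP₃.reverse hP₄.reverse
      h₁₂.reverse_left.reverse_right h₁₃.reverse_left.reverse_right
      h₁₄.reverse_left.reverse_right h₂₃.reverse_left.reverse_right
      h₂₄.reverse_left.reverse_right h₃₄.reverse_left.reverse_right (by simpa) (by simpa)
      hub hua hvb hva (by simpa using hR₁) (by simpa using hR₂) (by simpa using hR₃)
      (by simpa using hR₄) (by simpa) (by simpa) (by simpa using hF) B.reverse A.reverse
      hB.reverse hA.reverse (by simpa [or_comm] using hs)
      (by simpa [or_comm] using he) (fun z h h' => hAB z (by simpa using h') (by simpa using h))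
      (by simpa)
  obtain ⟨C, D, hC, hD, hs', he', hCD, -, -⟩ := exists_split hP₂ hv
  have hbA : b ∉ A.support := fun h => hub (hAB b h B.end_mem_support).symm
  have haB : a ∉ B.support := fun h => hua (hAB a A.start_mem_support h).symm
  have hbC : b ∉ C.support := fun h => hvb (hCD b h D.end_mem_support).symm
  have haD : a ∉ D.support := fun h => hva (hCD a C.start_mem_support h).symm
  have hAs : ∀ z, z ∈ A.support → z ∈ P₁.support := fun z h => (hs z).2 (.inl h)
  have hBs : ∀ z, z ∈ B.support → z ∈ P₁.support := fun z h => (hs z).2 (.inr h)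
  have hCs : ∀ z, z ∈ C.support → z ∈ P₂.support := fun z h => (hs' z).2 (.inl h)
  have hDs : ∀ z, z ∈ D.support → z ∈ P₂.support := fun z h => (hs' z).2 (.inr h)
  have start : ∀ {x y x' y' : V} {X : G.Walk x y} {Y : G.Walk x' y'},
      (∀ z, z ∈ X.support → z ∈ Y.support → z = a ∨ z = b) → b ∉ X.support →
      ∀ z, z ∈ X.support → z ∈ Y.support → z = a := fun h hb z h₁ h₂ =>
    (h z h₁ h₂).resolve_right fun h' => hb (h' ▸ h₁)
  have fin : ∀ {x y x' y' : V} {X : G.Walk x y} {Y : G.Walk x' y'},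
      (∀ z, z ∈ X.support → z ∈ Y.support → z = a ∨ z = b) → a ∉ X.support →
      ∀ z, z ∈ X.support → z ∈ Y.support → z = b := fun h hb z h₁ h₂ =>
    (h z h₁ h₂).resolve_left fun h' => hb (h' ▸ h₁)
  have hA₃ := start (X := A) (Y := P₃) (fun z h h' => (h₁₃.2 z (hAs z h) h').1) hbA
  have hA₄ := start (X := A) (Y := P₄) (fun z h h' => (h₁₄.2 z (hAs z h) h').1) hbA
  have hAC := start (X := A) (Y := C) (fun z h h' => (h₁₂.2 z (hAs z h) (hCs z h')).1) hbA
  have hAD := start (X := A) (Y := D) (fun z h h' => (h₁₂.2 z (hAs z h) (hDs z h')).1) hbA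
  have hC₃ := start (X := C) (Y := P₃) (fun z h h' => (h₂₃.2 z (hCs z h) h').1) hbC
  have hC₄ := start (X := C) (Y := P₄) (fun z h h' => (h₂₄.2 z (hCs z h) h').1) hbC
  have hB₃ := fin (X := B) (Y := P₃) (fun z h h' => (h₁₃.2 z (hBs z h) h').1) haB
  have hB₄ := fin (X := B) (Y := P₄) (fun z h h' => (h₁₄.2 z (hBs z h) h').1) haB
  have hBC := fin (X := B) (Y := C) (fun z h h' => (h₁₂.2 z (hBs z h) (hCs z h')).1) haB
  have hD₃ := fin (X := D) (Y := P₃) (fun z h h' => (h₂₃.2 z (hDs z h) h').1) haD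
  have hD₄ := fin (X := D) (Y := P₄) (fun z h h' => (h₂₄.2 z (hDs z h) h').1) haD
  -- If `e₂` lies on the half `C` at `a`, drop `D`: then `A` and `C` with `R` form a circle through
  -- `a` and `u`, linked by `B` to the circle of `P₃` and `P₄`. If `e₂` lies on `D`, drop `B` and
  -- `C`: then `A`, `R`, `D` make a single arm through both edges.
  rcases (he' e₂).1 he₂ with hm' | hm'
  · have hW : (C.append R.reverse).IsPath := isPath_append hC hR.reverse
      fun z h h' => hR₂ z (by simpa using h') (hCs z h)
    have hWs : ∀ z, z ∈ (C.append R.reverse).support ↔ z ∈ C.support ∨ z ∈ R.support := by simp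
    have hAW : InternallyDisjoint A (C.append R.reverse) := by
      refine ⟨fun e h h' => ?_, fun z h h' => ?_⟩
      · rw [Walk.edges_append, List.mem_append, Walk.edges_reverse, List.mem_reverse] at h'
        rcases h' with h' | h'
        · exact h₁₂.1 ((he e).2 (.inl h)) ((he' e).2 (.inl h'))
        · exact (internallyDisjoint_of_forall_eq (P := R) (Q := A) (w := u)
            (fun z h h' => hR₁ z h (hAs z h')) (by simp)).1 h' h
      · have : z = a ∨ z = u := ((hWs z).1 h').imp (hAC z h) fun h' => hR₁ z h' (hAs z h)
        exact ⟨this, this⟩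
    have hW₃ : ∀ z, z ∈ (C.append R.reverse).support → z ∈ P₃.support → z = a := fun z h h' =>
      ((hWs z).1 h).elim (fun h => hC₃ z h h') fun h => (hR₃ z h h').elim
    have hW₄ : ∀ z, z ∈ (C.append R.reverse).support → z ∈ P₄.support → z = a := fun z h h' =>
      ((hWs z).1 h).elim (fun h => hC₄ z h h') fun h => (hR₄ z h h').elim
    have hWB : ∀ z, z ∈ (C.append R.reverse).support → z ∈ B.support → z = u := fun z h h' =>
      ((hWs z).1 h).elim (fun h => (hbC (hBC z h' h ▸ h)).elim) fun h => hR₁ z h (hBs z h')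
    refine inBasic_of_happyFace (P₁ := A) (P₂ := C.append R.reverse) (Q₁ := P₃) (Q₂ := P₄)
      (R := B) hua.symm hab hub hA hW hP₃ hP₄ hB hAW
      (internallyDisjoint_of_forall_eq hA₃ (by simp))
      (internallyDisjoint_of_forall_eq hA₄ (by simp))
      (internallyDisjoint_of_forall_eq hW₃ (by simp))
      (internallyDisjoint_of_forall_eq hW₄ (by simp))
      (internallyDisjoint_of_forall_eq hAB (by simp))
      (internallyDisjoint_of_forall_eq hWB (by simp)) h₃₄
      (internallyDisjoint_of_forall_eq hB₃ (by simp)).symm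
      (internallyDisjoint_of_forall_eq hB₄ (by simp)).symm ?_
    intro e h
    rcases hF e h with rfl | rfl | h | h
    · exact .inl hm
    · exact .inr (.inl (by simp [hm']))
    · exact .inr (.inr (.inl h))
    · exact .inr (.inr (.inr (.inl h)))
  · have hRD : (R.append D).IsPath := isPath_append hR hD fun z h h' => hR₂ z h (hDs z h')
    have hT : (A.append (R.append D)).IsPath := by
      refine isPath_append hA hRD fun z h h' => ?_
      rw [Walk.mem_support_append_iff] at h'
      rcases h' with h' | h'
      · exact hR₁ z h' (hAs z h)
      · exact (haD (hAD z h h' ▸ h')).elim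
    have key : ∀ X : G.Walk a b, (∀ z, z ∈ A.support → z ∈ X.support → z = a) →
        (∀ z, z ∈ R.support → z ∈ X.support → False) →
        (∀ z, z ∈ D.support → z ∈ X.support → z = b) →
        InternallyDisjoint (A.append (R.append D)) X := by
      intro X h₁ h₂ h₃
      refine ⟨fun e h h' => ?_, fun z h h' => ?_⟩
      · simp only [Walk.edges_append, List.mem_append] at h
        rcases h with h | h | h
        · exact (internallyDisjoint_of_forall_eq h₁ (by simp)).1 h h'
        · exact (internallyDisjoint_of_forall_not h₂).1 h h'
        · exact (internallyDisjoint_of_forall_eq h₃ (by simp)).1 h h'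
      · simp only [Walk.mem_support_append_iff] at h
        have : z = a ∨ z = b := by
          rcases h with h | h | h
          · exact .inl (h₁ z h h')
          · exact (h₂ z h h').elim
          · exact .inr (h₃ z h h')
        exact ⟨this, this⟩
    refine inBasic_of_theta hab hT hP₃ hP₄ (key P₃ hA₃ hR₃ hD₃) (key P₄ hA₄ hR₄ hD₄) h₃₄ ?_
    intro e h
    rcases hF e h with rfl | rfl | h | h
    · exact .inl (by simp [hm])
    · exact .inl (by simp [hm'])
    · exact .inr (.inl h)
    · exact .inr (.inr h)

/-! ### Four arms and separating pairs of vertices -/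

/-- Whenever four edges and two vertices `a`, `b` are given, two of the edges can be joined by
a walk avoiding `a` and `b`. -/
def NoFourCut (G : SimpleGraph V) : Prop :=
  ∀ a b : V, a ≠ b → ∀ e : Fin 4 → Sym2 V, Function.Injective e → (∀ i, e i ∈ G.edgeSet) →
    ∃ i j, i ≠ j ∧ ∃ x ∈ e i, ∃ y ∈ e j, ∃ W : G.Walk x y, a ∉ W.support ∧ b ∉ W.support

lemma inBasic_of_four_arms (hcut : NoFourCut G) {a b : V} {P : Fin 4 → G.Walk a b} (hP : Arms P)
    {e : Fin 4 → Sym2 V} (he : ∀ i, e i ∈ (P i).edges) : InBasic G (Set.range e) := by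
  classical
  have hinj : Function.Injective e := fun i j hij => by
    by_contra h
    exact (hP.disj i j h).1 (he i) (hij ▸ he j)
  obtain ⟨i, j, hij, x, hx, y, hy, W, haW, hbW⟩ :=
    hcut a b hP.ne e hinj fun i => (P i).edges_subset_edgeSet (he i)
  -- The target is the union of all other arms, so that `R` avoids the two arms it does not join;
  -- the arm `l` where it ends need not be `j`.
  obtain ⟨u, v, R, hR, hu, ⟨l, hl, hv⟩, hRW, hRe⟩ := exists_subpath_between {z | z ∈ (P i).support}
    {z | ∃ l, l ≠ i ∧ z ∈ (P l).support} W.bypass_isPath (mem_support_of_mem (he i) hx)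
    ⟨j, hij.symm, mem_support_of_mem (he j) hy⟩
  have hRab : ∀ z, z ∈ R.support → z ≠ a ∧ z ≠ b := fun z hz => by
    have := W.support_bypass_subset_support (hRW z hz)
    constructor <;> rintro rfl <;> contradiction
  have hother : ∀ m, m ≠ i → m ≠ l → ∀ z, z ∈ R.support → z ∈ (P m).support → False := by
    intro m hmi hml z hz hzm
    have hzv := (hRe z hz).2 ⟨m, hmi, hzm⟩
    have := ((hP.disj m l hml).2 z hzm (hzv ▸ hv)).1
    have := hRab z hz
    tauto
  obtain ⟨m, n, hmi, hml, hni, hnl, hmn, hall⟩ : ∃ m n : Fin 4, m ≠ i ∧ m ≠ l ∧ n ≠ i ∧ n ≠ l ∧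
      m ≠ n ∧ ∀ k, k = i ∨ k = l ∨ k = m ∨ k = n := by
    clear * - hl
    revert i l
    decide
  have hu' := hRab u R.start_mem_support
  have hv' := hRab v R.end_mem_support
  refine inBasic_of_four_arms_aux (P₁ := P i) (P₂ := P l) (P₃ := P m) (P₄ := P n) (R := R) hP.ne
    (hP.isPath i) (hP.isPath l) (hP.isPath m) (hP.isPath n) hR (hP.disj _ _ hl.symm)
    (hP.disj _ _ hmi.symm) (hP.disj _ _ hni.symm) (hP.disj _ _ hml.symm) (hP.disj _ _ hnl.symm)
    (hP.disj _ _ hmn) hu hv hu'.1 hu'.2 hv'.1 hv'.2 (fun z h h' => (hRe z h).1 h')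
    (fun z h h' => (hRe z h).2 ⟨l, hl, h'⟩) (hother m hmi hml) (hother n hni hnl) (he i) (he l) ?_
  rintro _ ⟨k, rfl⟩
  rcases hall k with rfl | rfl | rfl | rfl
  · exact .inl rfl
  · exact .inr (.inl rfl)
  · exact .inr (.inr (.inl (he k)))
  · exact .inr (.inr (.inr (he k)))

/-! ### Collecting three and four edges by adding ears -/

/-- Three edges lie on a common cycle or on different arms of a theta-curve. -/
lemma CyclicallyConnected.exists_cycle_or_arms (hG : CyclicallyConnected G) (e : Fin 3 → Sym2 V)
    (he : ∀ i, e i ∈ G.edgeSet) :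
    (∃ (x : V) (c : G.Walk x x), c.IsCycle ∧ ∀ i, e i ∈ c.edges) ∨
    ∃ (a b : V) (P : Fin 3 → G.Walk a b), Arms P ∧ ∀ i, e i ∈ (P i).edges := by
  obtain ⟨x, c, hc, h0, h1⟩ := hG.onCommonCycle (he 0) (he 1)
  by_cases h2 : e 2 ∈ c.edges
  · exact .inl ⟨x, c, hc, by simp [Fin.forall_fin_succ, h0, h1, h2]⟩
  obtain ⟨u, v, Q, hQ, hu, hv, h2Q, hQS⟩ := hG.exists_ear {z | z ∈ c.support} (he 2) (he 0)
    (fun h => h2 (h ▸ h0)) fun z hz => mem_support_of_mem h0 hz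
  have huv := ne_of_mem_edges hQ h2Q
  obtain ⟨A, B, hA, hB, hAB, hcE, hcS⟩ := exists_arms_of_isCycle hc hu hv huv
  have hAQ : InternallyDisjoint A Q := by
    refine ⟨disjoint_edges_of_ear hQ h2Q hQS
      (fun z hz => (hcS z).2 (.inl hz)) (fun h => h2 ((hcE _).2 (.inl h))), fun z h₁ h₂ => ?_⟩
    exact ⟨hQS z h₂ ((hcS z).2 (.inl h₁)), hQS z h₂ ((hcS z).2 (.inl h₁))⟩
  have hBQ : InternallyDisjoint B Q := by
    refine ⟨disjoint_edges_of_ear hQ h2Q hQS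
      (fun z hz => (hcS z).2 (.inr hz)) (fun h => h2 ((hcE _).2 (.inr h))), fun z h₁ h₂ => ?_⟩
    exact ⟨hQS z h₂ ((hcS z).2 (.inr h₁)), hQS z h₂ ((hcS z).2 (.inr h₁))⟩
  have arms : ∀ X Y : G.Walk u v, X.IsPath → Y.IsPath → InternallyDisjoint X Y →
      InternallyDisjoint X Q → InternallyDisjoint Y Q → Arms ![X, Y, Q] := by
    intro X Y hX hY hXY hXQ hYQ
    refine ⟨huv, fun i => ?_, fun i j hij => ?_⟩
    · fin_cases i <;> assumption
    · fin_cases i <;> fin_cases j <;>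
        first | exact absurd rfl hij | assumption | (apply InternallyDisjoint.symm; assumption)
  -- If the first two edges are on the same arm of the cycle, that arm and the ear form a cycle
  -- through all three; otherwise the edges are on different arms of a theta-curve.
  rcases (hcE _).1 h0 with h0 | h0 <;> rcases (hcE _).1 h1 with h1 | h1
  · exact .inl ⟨u, _, exists_isCycle_of_arms huv hA hQ hAQ, by
      simp [Fin.forall_fin_succ, h0, h1, h2Q]⟩
  · exact .inr ⟨u, v, _, arms A B hA hB hAB hAQ hBQ, by
      simp [Fin.forall_fin_succ, h0, h1, h2Q]⟩
  · exact .inr ⟨u, v, _, arms B A hB hA hAB.symm hBQ hAQ, by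
      simp [Fin.forall_fin_succ, h0, h1, h2Q]⟩
  · exact .inl ⟨u, _, exists_isCycle_of_arms huv hB hQ hBQ, by
      simp [Fin.forall_fin_succ, h0, h1, h2Q]⟩

/-- Four edges lie in a basic `4`-ac subgraph unless two vertices separate them. -/
theorem CyclicallyConnected.inBasic_range (hG : CyclicallyConnected G) (hcut : NoFourCut G)
    (e : Fin 4 → Sym2 V) (he : ∀ i, e i ∈ G.edgeSet) : InBasic G (Set.range e) := by
  rcases hG.exists_cycle_or_arms (fun i => e i.castSucc) fun i => he _ with
    ⟨x, c, hc, hm⟩ | ⟨a, b, P, hP, hm⟩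
  · by_cases h3 : e 3 ∈ c.edges
    · refine inBasic_of_isCycle hc ?_
      rintro _ ⟨i, rfl⟩
      refine Fin.lastCases ?_ (fun i => hm i) i
      exact h3
    obtain ⟨u, v, Q, hQ, hu, hv, h3Q, hQS⟩ := hG.exists_ear {z | z ∈ c.support} (he 3) (he 0)
      (fun h => h3 (h ▸ hm 0)) fun z hz => mem_support_of_mem (hm 0) hz
    have huv := ne_of_mem_edges hQ h3Q
    obtain ⟨A, B, hA, hB, hAB, hcE, hcS⟩ := exists_arms_of_isCycle hc hu hv huv
    refine inBasic_of_theta huv hA hB hQ hAB ?_ ?_ ?_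
    · refine ⟨disjoint_edges_of_ear hQ h3Q hQS
        (fun z hz => (hcS z).2 (.inl hz)) (fun h => h3 ((hcE _).2 (.inl h))), fun z h₁ h₂ => ?_⟩
      exact ⟨hQS z h₂ ((hcS z).2 (.inl h₁)), hQS z h₂ ((hcS z).2 (.inl h₁))⟩
    · refine ⟨disjoint_edges_of_ear hQ h3Q hQS
        (fun z hz => (hcS z).2 (.inr hz)) (fun h => h3 ((hcE _).2 (.inr h))), fun z h₁ h₂ => ?_⟩
      exact ⟨hQS z h₂ ((hcS z).2 (.inr h₁)), hQS z h₂ ((hcS z).2 (.inr h₁))⟩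
    · rintro _ ⟨i, rfl⟩
      refine Fin.lastCases ?_ (fun i => ?_) i
      · exact .inr (.inr h3Q)
      · exact (or_assoc.1 (.inl ((hcE _).1 (hm i))))
  · by_cases h3 : ∃ i, e 3 ∈ (P i).edges
    · refine inBasic_of_arms hP ?_
      rintro _ ⟨i, rfl⟩
      exact Fin.lastCases (motive := fun i => ∃ j, e i ∈ (P j).edges) h3 (fun i => ⟨i, hm i⟩) i
    push Not at h3
    obtain ⟨u, v, Q, hQ, ⟨i, hu⟩, ⟨j, hv⟩, h3Q, hQS⟩ := hG.exists_ear
      {z | ∃ i, z ∈ (P i).support} (he 3) (he 0)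
      (fun h => h3 0 (h ▸ hm 0)) fun z hz => ⟨0, mem_support_of_mem (hm 0) hz⟩
    have huv := ne_of_mem_edges hQ h3Q
    have hQP : ∀ i, (P i).edges.Disjoint Q.edges := fun i =>
      disjoint_edges_of_ear hQ h3Q hQS (fun z hz => ⟨i, hz⟩) (h3 i)
    -- Since `a` and `b` lie on every arm, the negative case means that `u` and `v` are inner
    -- vertices of different arms.
    by_cases hsame : ∃ i, u ∈ (P i).support ∧ v ∈ (P i).support
    · clear! i j
      obtain ⟨i, hu, hv⟩ := hsame
      obtain ⟨j, k, hij, hik, hjk, hall⟩ : ∃ j k : Fin 3, i ≠ j ∧ i ≠ k ∧ j ≠ k ∧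
          ∀ l, l = i ∨ l = j ∨ l = k := by
        clear * -
        revert i
        decide
      -- The ear joins the branch vertices and becomes a fourth arm; the argument uses `hcut` only
      -- here.
      have four : ∀ Q' : G.Walk a b, Q'.IsPath → e 3 ∈ Q'.edges →
          (∀ i, (P i).edges.Disjoint Q'.edges) →
          (∀ z, z ∈ Q'.support → (∃ i, z ∈ (P i).support) → z = a ∨ z = b) →
          InBasic G (Set.range e) := by
        intro Q' hQ' h3' hd hs
        have hPQ : ∀ i, InternallyDisjoint (P i) Q' := fun i =>
          ⟨hd i, fun z h h' => ⟨hs z h' ⟨i, h⟩, hs z h' ⟨i, h⟩⟩⟩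
        refine inBasic_of_four_arms hcut (P := Fin.snoc (α := fun _ => G.Walk a b) P Q')
          ⟨hP.ne, ?_, ?_⟩ ?_
        · intro i
          refine Fin.lastCases ?_ (fun i => ?_) i
          · simpa
          · simpa using hP.isPath i
        · intro i j
          refine Fin.lastCases ?_ (fun i => ?_) i <;> refine Fin.lastCases ?_ (fun j => ?_) j
          · simp
          · intro _
            rw [Fin.snoc_last, Fin.snoc_castSucc]
            exact (hPQ j).symm
          · intro _
            rw [Fin.snoc_last, Fin.snoc_castSucc]
            exact hPQ i
          · simpa using hP.disj i j
        · intro i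
          refine Fin.lastCases ?_ (fun i => ?_) i
          · rw [Fin.snoc_last]
            exact h3'
          · simpa using hm i
      by_cases h₁ : u = a ∧ v = b
      · obtain ⟨rfl, rfl⟩ := h₁
        exact four Q hQ h3Q hQP hQS
      by_cases h₂ : u = b ∧ v = a
      · obtain ⟨rfl, rfl⟩ := h₂
        exact four Q.reverse hQ.reverse (by simpa) (by simpa)
          (fun z hz hz' => (hQS z (by simpa using hz) hz').symm)
      refine inBasic_of_chord (P := P i) (P₁ := P j) (P₂ := P k) (Q := Q) hP.ne (hP.isPath i)
        (hP.isPath j) (hP.isPath k) hQ (hP.disj _ _ hij) (hP.disj _ _ hik) (hP.disj _ _ hjk) hu hv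
        huv h₁ h₂ (hQP i) (hQP j) (hQP k) ?_ ?_
      · rintro z hz (h | h | h)
        exacts [hQS z hz ⟨_, h⟩, hQS z hz ⟨_, h⟩, hQS z hz ⟨_, h⟩]
      · rintro _ ⟨l, rfl⟩
        refine Fin.lastCases ?_ (fun l => ?_) l
        · exact .inr (.inr (.inr h3Q))
        · have := hm l
          rcases hall l with rfl | rfl | rfl <;> tauto
    · push Not at hsame
      have hij : i ≠ j := by
        rintro rfl
        exact hsame _ hu hv
      obtain ⟨k, hik, hjk, hall⟩ : ∃ k : Fin 3, i ≠ k ∧ j ≠ k ∧ ∀ l, l = i ∨ l = j ∨ l = k := by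
        clear * - hij
        revert i j
        decide
      refine inBasic_of_crossing (P₁ := P i) (P₂ := P j) (P₃ := P k) (Q := Q) hP.ne (hP.isPath i)
        (hP.isPath j) (hP.isPath k) hQ (hP.disj _ _ hij) (hP.disj _ _ hik) (hP.disj _ _ hjk) hu hv
        ?_ ?_ ?_ ?_ ?_ (hm i) ?_
      · rintro rfl; exact hsame j (by simp) hv
      · rintro rfl; exact hsame j (by simp) hv
      · rintro rfl; exact hsame i hu (by simp)
      · rintro rfl; exact hsame i hu (by simp)
      · rintro z hz (h | h | h)
        exacts [hQS z hz ⟨_, h⟩, hQS z hz ⟨_, h⟩, hQS z hz ⟨_, h⟩]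
      · rintro _ ⟨l, rfl⟩
        refine Fin.lastCases ?_ (fun l => ?_) l
        · exact .inr (.inr (.inr h3Q))
        · have := hm l
          rcases hall l with rfl | rfl | rfl <;> tauto

end Combinatorics
/-! ### Arcs in Hausdorff spaces -/

section Arcs

open Set

variable {X : Type u} [TopologicalSpace X]

/-- `A` is an arc with end points `x` and `y`. -/
def ArcBetween (x y : X) (A : Set X) : Prop :=
  ∃ γ : Path x y, Function.Injective γ ∧ range γ = A

lemma ArcBetween.isArc [T2Space X] {x y : X} {A : Set X} (h : ArcBetween x y A) : IsArc A := by
  obtain ⟨γ, hγ, rfl⟩ := h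
  exact ⟨(γ.continuous.isClosedEmbedding hγ).isEmbedding.toHomeomorph.symm⟩

lemma ArcBetween.symm {x y : X} {A : Set X} (h : ArcBetween x y A) : ArcBetween y x A := by
  obtain ⟨γ, hγ, rfl⟩ := h
  refine ⟨γ.symm, ?_, Path.symm_range γ⟩
  exact hγ.comp unitInterval.symm_bijective.injective

lemma ArcBetween.left_mem {x y : X} {A : Set X} (h : ArcBetween x y A) : x ∈ A := by
  obtain ⟨γ, -, rfl⟩ := h
  exact ⟨0, γ.source⟩

lemma ArcBetween.right_mem {x y : X} {A : Set X} (h : ArcBetween x y A) : y ∈ A :=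
  h.symm.left_mem

lemma ArcBetween.trans {x y z : X} {A B : Set X} (hA : ArcBetween x y A) (hB : ArcBetween y z B)
    (h : ∀ p ∈ A, p ∈ B → p = y) : ArcBetween x z (A ∪ B) := by
  obtain ⟨γ, hγ, rfl⟩ := hA
  obtain ⟨δ, hδ, rfl⟩ := hB
  refine ⟨γ.trans δ, ?_, Path.trans_range γ δ⟩
  have cross : ∀ s t : unitInterval, γ s = δ t → s = 1 ∧ t = 0 := by
    intro s t hst
    have hy := h (γ s) ⟨s, rfl⟩ ⟨t, hst.symm⟩
    exact ⟨hγ (hy.trans γ.target.symm), hδ ((hst.symm.trans hy).trans δ.source.symm)⟩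
  intro s t hst
  rw [Path.trans_apply, Path.trans_apply] at hst
  split_ifs at hst with hs ht ht
  · have := congrArg Subtype.val (hγ hst)
    exact Subtype.ext (by simpa using this)
  · have := congrArg Subtype.val (cross _ _ hst).2
    simp only [Icc.coe_zero] at this
    linarith
  · have := congrArg Subtype.val (cross _ _ hst.symm).2
    simp only [Icc.coe_zero] at this
    linarith
  · have := congrArg Subtype.val (hδ hst)
    simp only at this
    exact Subtype.ext (by linarith)

/-- An arc may be shortened at an end without losing points of a given finite set. -/
lemma ArcBetween.exists_truncation {x y : X} {A S : Set X} (hA : ArcBetween x y A)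
    (hS : S.Finite) : ∃ z A', ArcBetween x z A' ∧ A' ⊆ A ∧ y ∉ A' ∧
      ∀ p ∈ S, p ∈ A → p ∈ A' ∨ p = y := by
  obtain ⟨γ, hγ, rfl⟩ := hA
  let half : unitInterval := ⟨1 / 2, by norm_num, by norm_num⟩
  -- The arc is cut at the last parameter below `1` that belongs to `S`; `half` is inserted so that
  -- the maximum exists and is positive.
  have hT : (insert half (γ ⁻¹' S \ {1})).Finite :=
    ((hS.preimage hγ.injOn).subset sdiff_subset).insert _
  obtain ⟨t, ht, hmax⟩ := exists_max_image _ id hT ⟨half, mem_insert _ _⟩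
  have ht0 : (0 : ℝ) < t := by
    have := hmax half (mem_insert _ _)
    have h' : ((half : unitInterval) : ℝ) ≤ t := this
    exact lt_of_lt_of_le (by change (0 : ℝ) < 1 / 2; norm_num) h'
  have ht1 : t < 1 := by
    rcases ht with rfl | ht
    · rw [← Subtype.coe_lt_coe]
      change (1 / 2 : ℝ) < 1
      norm_num
    · exact lt_of_le_of_ne unitInterval.le_one' ht.2
  have hmul : Function.Injective fun s : unitInterval => t * s := by
    intro r s hrs
    have : (t : ℝ) * r = t * s := congrArg Subtype.val hrs
    exact Subtype.ext (mul_left_cancel₀ ht0.ne' this)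
  refine ⟨γ t, range fun s : unitInterval => γ (t * s), ⟨⟨⟨fun s => γ (t * s), by fun_prop⟩, by simp,
    by simp⟩, hγ.comp hmul, rfl⟩, ?_, ?_, ?_⟩
  · rintro _ ⟨s, rfl⟩
    exact ⟨_, rfl⟩
  · rintro ⟨s, hs⟩
    have h1 : t * s = 1 := hγ (hs.trans γ.target.symm)
    have : t * s ≤ t := unitInterval.mul_le_left
    exact absurd (h1 ▸ this) (not_le.2 ht1)
  · rintro _ hp ⟨r, rfl⟩
    by_cases hr : r = 1
    · exact .inr (hr ▸ γ.target)
    · refine .inl ?_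
      have hrt : r ≤ t := hmax r (mem_insert_of_mem _ ⟨hp, hr⟩)
      have hrt' : (r : ℝ) ≤ t := hrt
      refine ⟨⟨r / t, div_nonneg r.2.1 ht0.le, (div_le_one ht0).2 hrt'⟩, ?_⟩
      change γ _ = γ r
      congr 1
      refine Subtype.ext ?_
      change (t : ℝ) * (r / t) = r
      field_simp

/-- Prolong the arc `B` at its end `p` by almost all of the arc `A`. -/
lemma ArcBetween.exists_prolongation {p p' q : X} {A B S : Set X} (hA : ArcBetween p p' A)
    (hB : ArcBetween p q B) (hS : S.Finite) (hAB : ∀ z ∈ A, z ∈ B → z = p ∨ z = p')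
    (hp' : p' ∈ B) : ∃ z D, ArcBetween z q D ∧ (∀ z ∈ D, z ∈ B ∨ z ∈ A ∧ z ≠ p') ∧ B ⊆ D ∧
      ∀ z ∈ S, z ∈ A → z ∈ D := by
  obtain ⟨z, A', hA', hsub, hy, hcov⟩ := hA.exists_truncation hS
  refine ⟨z, A' ∪ B, hA'.symm.trans hB fun w hw hw' => ?_, ?_, subset_union_right, ?_⟩
  · exact (hAB w (hsub hw) hw').resolve_right fun h => hy (h ▸ hw)
  · rintro w (hw | hw)
    · exact .inr ⟨hsub hw, fun h => hy (h ▸ hw)⟩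
    · exact .inl hw
  · intro w hw hwA
    rcases hcov w hw hwA with h | rfl
    · exact .inl h
    · exact .inr hp'

/-- Some arc contains `S`. -/
def InArc (S : Set X) : Prop := ∃ A : Set X, IsArc A ∧ S ⊆ A

variable [T2Space X]

/-- Prolong `B` at `p` by `A` almost up to `p'`, then at `q` by `C` almost up to `q'`. The points
`p'` and `q'` that get lost are on `B` anyway, and by `hAC` the two prolongations could only meet
there. -/
lemma inArc_of_chain {p p' q q' : X} {A B C S : Set X} (hA : ArcBetween p p' A)
    (hB : ArcBetween p q B) (hC : ArcBetween q q' C) (hS : S.Finite)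
    (hAB : ∀ z ∈ A, z ∈ B → z = p ∨ z = p') (hBC : ∀ z ∈ C, z ∈ B → z = q ∨ z = q')
    (hAC : ∀ z ∈ A, z ∈ C → z = p' ∨ z = q') (hp' : p' ∈ B) (hq' : q' ∈ B)
    (hcov : ∀ z ∈ S, z ∈ A ∨ z ∈ B ∨ z ∈ C) : InArc S := by
  obtain ⟨z, D, hD, hDs, hBD, hSD⟩ := hA.exists_prolongation hB hS hAB hp'
  obtain ⟨w, E, hE, -, hDE, hSE⟩ := hC.exists_prolongation hD.symm hS (fun z hz hz' => by
    rcases hDs z hz' with h | h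
    · exact hBC z hz h
    · exact .inr ((hAC z h.1 hz).resolve_left h.2)) (hBD hq')
  refine ⟨E, hE.isArc, fun x hx => ?_⟩
  rcases hcov x hx with h | h | h
  · exact hDE (hSD x hx h)
  · exact hDE (hBD h)
  · exact hSE x hx h

lemma inArc_of_circle {x y : X} {A B S : Set X} (hA : ArcBetween x y A) (hB : ArcBetween x y B)
    (hS : S.Finite) (hAB : ∀ z ∈ A, z ∈ B → z = x ∨ z = y) (hcov : ∀ z ∈ S, z ∈ A ∨ z ∈ B) :
    InArc S := by
  obtain ⟨z, D, hD, -, hBD, hSD⟩ := hA.exists_prolongation hB hS hAB hB.right_mem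
  refine ⟨D, hD.isArc, fun x hx => ?_⟩
  rcases hcov x hx with h | h
  · exact hSD x hx h
  · exact hBD h

lemma inArc_of_theta {x y : X} {A B C S : Set X} (hA : ArcBetween x y A) (hB : ArcBetween x y B)
    (hC : ArcBetween x y C) (hS : S.Finite) (hAB : ∀ z ∈ A, z ∈ B → z = x ∨ z = y)
    (hAC : ∀ z ∈ A, z ∈ C → z = x ∨ z = y) (hBC : ∀ z ∈ B, z ∈ C → z = x ∨ z = y)
    (hcov : ∀ z ∈ S, z ∈ A ∨ z ∈ B ∨ z ∈ C) : InArc S :=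
  inArc_of_chain hA hB hC.symm hS hAB (fun z h h' => (hBC z h' h).symm)
    (fun z h h' => (hAC z h h').symm) hB.right_mem hB.left_mem hcov

/-- A happy-face curve without one of the two arms of a circle is a theta-curve. -/
lemma inArc_of_theta' {x y w : X} {A B C D S : Set X} (hA : ArcBetween x y A)
    (hB : ArcBetween x y B) (hC : ArcBetween x w C) (hD : ArcBetween w y D) (hS : S.Finite)
    (hAB : ∀ z ∈ A, z ∈ B → z = x ∨ z = y)
    (hAC : ∀ z ∈ A, z ∈ C → z = x ∨ z = y) (hBC : ∀ z ∈ B, z ∈ C → z = x ∨ z = y)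
    (hAD : ∀ z ∈ A, z ∈ D → z = x ∨ z = y) (hBD : ∀ z ∈ B, z ∈ D → z = x ∨ z = y)
    (hCD : ∀ z ∈ C, z ∈ D → z = w)
    (hcov : ∀ z ∈ S, z ∈ A ∨ z ∈ B ∨ z ∈ C ∨ z ∈ D) : InArc S :=
  inArc_of_theta hA hB (hC.trans hD hCD) hS hAB (fun z h h' => h'.elim (hAC z h) (hAD z h))
    (fun z h h' => h'.elim (hBC z h) (hBD z h)) hcov

/-- The middle of the chain runs from `b` through `a` to `c`; the second arc of each circle is
attached at `b` or `c` and stops just short of `a`. -/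
lemma inArc_of_figureEight {a b c : X} {A₁ A₂ B₁ B₂ S : Set X} (hA₁ : ArcBetween a b A₁)
    (hA₂ : ArcBetween a b A₂) (hB₁ : ArcBetween a c B₁) (hB₂ : ArcBetween a c B₂) (hS : S.Finite)
    (hAA : ∀ z ∈ A₁, z ∈ A₂ → z = a ∨ z = b) (hBB : ∀ z ∈ B₁, z ∈ B₂ → z = a ∨ z = c)
    (h₁₁ : ∀ z ∈ A₁, z ∈ B₁ → z = a) (h₁₂ : ∀ z ∈ A₁, z ∈ B₂ → z = a)
    (h₂₁ : ∀ z ∈ A₂, z ∈ B₁ → z = a) (h₂₂ : ∀ z ∈ A₂, z ∈ B₂ → z = a)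
    (hcov : ∀ z ∈ S, z ∈ A₁ ∨ z ∈ A₂ ∨ z ∈ B₁ ∨ z ∈ B₂) : InArc S := by
  refine inArc_of_chain hA₁.symm (hA₂.symm.trans hB₁ h₂₁) hB₂.symm hS ?_ ?_ ?_
    (.inr hB₁.left_mem) (.inr hB₁.left_mem) ?_
  · rintro z h (h' | h')
    · exact (hAA z h h').symm
    · exact .inr (h₁₁ z h h')
  · rintro z h (h' | h')
    · exact .inr (h₂₂ z h' h)
    · exact (hBB z h' h).symm
  · exact fun z h h' => .inl (h₁₂ z h h')
  · intro z h
    have := hcov z h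
    simp only [mem_union]
    tauto

/-- The middle of the chain runs from `a` along `A₂`, `D` and `B₁` to `c`; `A₁` and `B₂` prolong it,
stopping just short of `b` and `d`. -/
lemma inArc_of_dumbbell {a b c d : X} {A₁ A₂ B₁ B₂ D S : Set X} (hA₁ : ArcBetween a b A₁)
    (hA₂ : ArcBetween a b A₂) (hB₁ : ArcBetween c d B₁) (hB₂ : ArcBetween c d B₂)
    (hD : ArcBetween b d D) (hS : S.Finite)
    (hAA : ∀ z ∈ A₁, z ∈ A₂ → z = a ∨ z = b) (hBB : ∀ z ∈ B₁, z ∈ B₂ → z = c ∨ z = d)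
    (h₁₁ : ∀ z ∈ A₁, z ∉ B₁) (h₁₂ : ∀ z ∈ A₁, z ∉ B₂)
    (h₂₁ : ∀ z ∈ A₂, z ∉ B₁) (h₂₂ : ∀ z ∈ A₂, z ∉ B₂)
    (hA₁D : ∀ z ∈ A₁, z ∈ D → z = b) (hA₂D : ∀ z ∈ A₂, z ∈ D → z = b)
    (hB₁D : ∀ z ∈ B₁, z ∈ D → z = d) (hB₂D : ∀ z ∈ B₂, z ∈ D → z = d)
    (hcov : ∀ z ∈ S, z ∈ A₁ ∨ z ∈ A₂ ∨ z ∈ B₁ ∨ z ∈ B₂ ∨ z ∈ D) : InArc S := by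
  have hmid : ArcBetween a c (A₂ ∪ (D ∪ B₁)) := by
    refine hA₂.trans (hD.trans hB₁.symm fun z h h' => hB₁D z h' h) ?_
    rintro z h (h' | h')
    · exact hA₂D z h h'
    · exact absurd h' (h₂₁ z h)
  refine inArc_of_chain hA₁ hmid hB₂ hS ?_ ?_ ?_ (.inl hA₂.right_mem)
    (.inr (.inr hB₁.right_mem)) ?_
  · rintro z h (h' | h' | h')
    · exact hAA z h h'
    · exact .inr (hA₁D z h h')
    · exact absurd h' (h₁₁ z h)
  · rintro z h (h' | h' | h')
    · exact absurd h (h₂₂ z h')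
    · exact .inr (hB₂D z h h')
    · exact hBB z h' h
  · exact fun z h h' => absurd h' (h₁₂ z h)
  · intro z h
    have := hcov z h
    simp only [mem_union]
    tauto

/-- If a set has fewer points than there are covering sets then one of these is not needed. -/
lemma exists_covered_without {X : Type u} {k : ℕ} {S : Set X} (A : Fin k → Set X)
    (hS : S.encard < k) (hcov : ∀ z ∈ S, ∃ i, z ∈ A i) :
    ∃ i, ∀ z ∈ S, ∃ j, j ≠ i ∧ z ∈ A j := by
  by_contra! h
  -- If every set is needed, each has a point of `S` that no other set covers; these points are
  -- distinct, so there are too many of them.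
  choose f hf hf' using h
  have hfA : ∀ i, f i ∈ A i := fun i => by
    obtain ⟨j, hj⟩ := hcov _ (hf i)
    by_cases hji : j = i
    · exact hji ▸ hj
    · exact absurd hj (hf' i j hji)
  have hinj : Function.Injective f := fun i j hij => by
    by_contra hne
    exact hf' j i hne (hij ▸ hfA i)
  have h1 : (range f).encard ≤ S.encard := encard_le_encard (by rintro _ ⟨i, rfl⟩; exact hf i)
  have h2 : (range f).encard = k := by
    rw [← image_univ, hinj.encard_image, encard_univ]
    simp
  rw [h2] at h1
  exact absurd hS (not_lt.2 h1)

end Arcs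
/-! ### The one-complex -/

section OneComplex

open Set SimpleGraph

variable {V : Type u} (G : SimpleGraph V)

/-- The point with coordinate `t` on the edge `e`. -/
def OneComplex.edgePoint (e : G.edgeSet) (t : unitInterval) : OneComplex G :=
  Quot.mk (Glue G) (Sum.inr ⟨e, t⟩)

variable {G}

/-- The end of an edge at which its coordinate is `0`. -/
noncomputable def src (e : G.edgeSet) : V := (Quot.out e.1).1

/-- The end of an edge at which its coordinate is `1`. -/
noncomputable def tgt (e : G.edgeSet) : V := (Quot.out e.1).2

lemma mk_src_tgt (e : G.edgeSet) : s(src e, tgt e) = e.1 := Quot.out_eq e.1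

lemma mem_edge_iff {e : G.edgeSet} {v : V} : v ∈ e.1 ↔ v = src e ∨ v = tgt e := by
  rw [← mk_src_tgt, Sym2.mem_iff]

lemma adj_src_tgt (e : G.edgeSet) : G.Adj (src e) (tgt e) := by
  rw [← mem_edgeSet, mk_src_tgt]
  exact e.2

namespace OneComplex

lemma edgePoint_zero (e : G.edgeSet) : edgePoint G e 0 = vertex G (src e) :=
  Quot.sound (Glue.zero e)

lemma edgePoint_one (e : G.edgeSet) : edgePoint G e 1 = vertex G (tgt e) :=
  Quot.sound (Glue.one e)

/-- The function on `|G|` with the values `α` at the vertices that is affine on each edge `e`,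
plus `β e` times the bump `t (1 - t)`. -/
noncomputable def bumpFun (α : V → ℝ) (β : G.edgeSet → ℝ) : OneComplex G → ℝ :=
  Quot.lift (Sum.elim α fun x =>
      (1 - (x.2 : ℝ)) * α (src x.1) + x.2 * α (tgt x.1) + β x.1 * (x.2 * (1 - x.2))) <| by
    rintro _ _ (e | e) <;> simp [src, tgt]

@[simp] lemma bumpFun_vertex (α : V → ℝ) (β : G.edgeSet → ℝ) (v : V) :
    bumpFun α β (vertex G v) = α v := rfl

@[simp] lemma bumpFun_edgePoint (α : V → ℝ) (β : G.edgeSet → ℝ) (e : G.edgeSet)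
    (t : unitInterval) : bumpFun α β (edgePoint G e t) =
      (1 - (t : ℝ)) * α (src e) + t * α (tgt e) + β e * (t * (1 - t)) := rfl

lemma continuous_bumpFun (α : V → ℝ) (β : G.edgeSet → ℝ) : Continuous (bumpFun α β) := by
  let _ : TopologicalSpace V := ⊥
  have : DiscreteTopology V := ⟨rfl⟩
  refine @continuous_quot_lift _ _ _ _ _ _ _ ?_
  refine Continuous.sumElim continuous_of_discreteTopology (continuous_sigma fun e => ?_)
  dsimp only
  fun_prop

lemma continuous_edgePoint (e : G.edgeSet) : Continuous (edgePoint G e) := by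
  let _ : TopologicalSpace V := ⊥
  exact continuous_quot_mk.comp (continuous_inr.comp continuous_sigmaMk)

lemma eq_vertex_or_edgePoint (x : OneComplex G) : (∃ v, x = vertex G v) ∨
    ∃ (e : G.edgeSet) (t : unitInterval), 0 < (t : ℝ) ∧ (t : ℝ) < 1 ∧ x = edgePoint G e t := by
  obtain ⟨v | ⟨e, t⟩, rfl⟩ := Quot.exists_rep x
  · exact .inl ⟨v, rfl⟩
  · by_cases h0 : t = 0
    · exact .inl ⟨src e, h0 ▸ edgePoint_zero e⟩
    by_cases h1 : t = 1
    · exact .inl ⟨tgt e, h1 ▸ edgePoint_one e⟩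
    · exact .inr ⟨e, t, unitInterval.pos_iff_ne_zero.2 h0, unitInterval.lt_one_iff_ne_one.2 h1, rfl⟩

lemma vertex_injective : Function.Injective (vertex G) := by
  classical
  intro v w h
  by_contra hne
  have := congrArg (bumpFun (Pi.single v 1) 0) h
  simp [Ne.symm hne] at this

lemma edgePoint_injective (e : G.edgeSet) : Function.Injective (edgePoint G e) := by
  classical
  intro s t h
  have := congrArg (bumpFun (Pi.single (src e) 1) 0) h
  simp [(adj_src_tgt e).ne'] at this
  exact Subtype.ext this

lemma edgePoint_ne_vertex {e : G.edgeSet} {t : unitInterval} (h0 : 0 < (t : ℝ)) (h1 : (t : ℝ) < 1)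
    (v : V) : edgePoint G e t ≠ vertex G v := by
  intro h
  have := congrArg (bumpFun 0 1) h
  simp only [bumpFun_edgePoint, bumpFun_vertex, Pi.zero_apply, Pi.one_apply] at this
  have := mul_pos h0 (sub_pos.2 h1)
  linarith

lemma edgePoint_ne_of_ne {e f : G.edgeSet} (hef : e ≠ f) {t : unitInterval} (h0 : 0 < (t : ℝ))
    (h1 : (t : ℝ) < 1) (s : unitInterval) : edgePoint G e t ≠ edgePoint G f s := by
  classical
  intro h
  have := congrArg (bumpFun 0 (Pi.single e 1)) h
  simp [hef.symm] at this
  rcases this with rfl | h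
  · simp at h0
  · linarith

/-- The functions `bumpFun` separate points, so no neighbourhoods of vertices of infinite degree
have to be described. An indicator `α` separates two vertices or two inner points of one edge, the
bump on all edges separates inner points from vertices, and the bump on one edge separates inner
points of different edges. -/
instance : T2Space (OneComplex G) := by
  classical
  have sep : ∀ x y : OneComplex G, (∀ α β, bumpFun α β x = bumpFun α β y) → x = y := by
    intro x y h
    rcases eq_vertex_or_edgePoint x with ⟨v, rfl⟩ | ⟨e, t, h0, h1, rfl⟩ <;>
      rcases eq_vertex_or_edgePoint y with ⟨w, rfl⟩ | ⟨f, s, h0', h1', rfl⟩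
    · by_contra hne
      have hne' : w ≠ v := by rintro rfl; exact hne rfl
      have := h (Pi.single v 1) 0
      simp [hne'] at this
    · have := h 0 1
      simp only [bumpFun_edgePoint, bumpFun_vertex, Pi.zero_apply, Pi.one_apply] at this
      have := mul_pos h0' (sub_pos.2 h1')
      linarith
    · have := h 0 1
      simp only [bumpFun_edgePoint, bumpFun_vertex, Pi.zero_apply, Pi.one_apply] at this
      have := mul_pos h0 (sub_pos.2 h1)
      linarith
    · by_cases hef : e = f
      · subst hef
        have := h (Pi.single (src e) 1) 0
        simp [(adj_src_tgt e).ne'] at this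
        rw [Subtype.ext this]
      · have := h 0 (Pi.single e 1)
        simp [Ne.symm hef] at this
        rcases this with rfl | h
        · simp at h0
        · linarith
  refine ⟨fun x y hne => ?_⟩
  have : ∃ α β, bumpFun α β x ≠ bumpFun α β y := by
    by_contra! h
    exact hne (sep x y h)
  obtain ⟨α, β, h⟩ := this
  exact separated_by_continuous (continuous_bumpFun α β) h

/-- The closed edge `e` as a set of points of `|G|`. -/
def cell (G : SimpleGraph V) (e : Sym2 V) : Set (OneComplex G) :=
  {x | ∃ h : e ∈ G.edgeSet, x ∈ range (edgePoint G ⟨e, h⟩)}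

lemma eq_vertex_of_mem_cell {e f : Sym2 V} (hef : e ≠ f) {x : OneComplex G} (he : x ∈ cell G e)
    (hf : x ∈ cell G f) : ∃ v, v ∈ e ∧ v ∈ f ∧ x = vertex G v := by
  obtain ⟨he, t, rfl⟩ := he
  obtain ⟨hf, s, hs⟩ := hf
  have key : ∀ {e f : G.edgeSet}, e ≠ f → ∀ {s t : unitInterval}, edgePoint G f s = edgePoint G e t →
      ∃ v ∈ e.1, edgePoint G e t = vertex G v := by
    intro e f hef s t h
    by_cases h0 : t = 0
    · exact ⟨src e, mem_edge_iff.2 (.inl rfl), h0 ▸ edgePoint_zero e⟩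
    by_cases h1 : t = 1
    · exact ⟨tgt e, mem_edge_iff.2 (.inr rfl), h1 ▸ edgePoint_one e⟩
    · exact absurd h.symm (edgePoint_ne_of_ne hef (unitInterval.pos_iff_ne_zero.2 h0)
        (unitInterval.lt_one_iff_ne_one.2 h1) s)
  have hne : (⟨e, he⟩ : G.edgeSet) ≠ ⟨f, hf⟩ := fun h => hef (congrArg Subtype.val h)
  obtain ⟨v, hv, hv'⟩ := key hne hs
  obtain ⟨w, hw, hw'⟩ := key hne.symm hs.symm
  have : v = w := vertex_injective (hv'.symm.trans (hs.symm.trans hw'))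
  exact ⟨v, hv, this ▸ hw, hv'⟩

lemma vertex_mem_cell {e : Sym2 V} (he : e ∈ G.edgeSet) {v : V} (hv : v ∈ e) :
    vertex G v ∈ cell G e := by
  rcases (mem_edge_iff (e := ⟨e, he⟩)).1 hv with rfl | rfl
  · exact ⟨he, 0, edgePoint_zero _⟩
  · exact ⟨he, 1, edgePoint_one _⟩

lemma arcBetween_cell {p q : V} (h : G.Adj p q) :
    ArcBetween (vertex G p) (vertex G q) (cell G s(p, q)) := by
  let e : G.edgeSet := ⟨s(p, q), h⟩
  have hcell : cell G s(p, q) = range (edgePoint G e) := by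
    ext x
    exact ⟨fun ⟨_, hx⟩ => hx, fun hx => ⟨h, hx⟩⟩
  have key : ArcBetween (vertex G (src e)) (vertex G (tgt e)) (cell G s(p, q)) :=
    ⟨⟨⟨edgePoint G e, continuous_edgePoint e⟩, edgePoint_zero e, edgePoint_one e⟩,
      edgePoint_injective e, hcell.symm⟩
  rcases Sym2.eq_iff.1 (mk_src_tgt e) with ⟨h1, h2⟩ | ⟨h1, h2⟩
  · rwa [h1, h2] at key
  · rw [h1, h2] at key
    exact key.symm

/-- The points on the edges of a walk. -/
def carrier {a b : V} (P : G.Walk a b) : Set (OneComplex G) := {x | ∃ e ∈ P.edges, x ∈ cell G e}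

/-- The trivial walk has an empty carrier, so the induction really starts at a single edge. -/
lemma arcBetween_carrier {a b : V} {P : G.Walk a b} (hP : P.IsPath) (hab : a ≠ b) :
    ArcBetween (vertex G a) (vertex G b) (carrier P) := by
  induction P with
  | nil => exact absurd rfl hab
  | @cons a c b h P ih =>
    rw [Walk.cons_isPath_iff] at hP
    have hcar : carrier (Walk.cons h P) = cell G s(a, c) ∪ carrier P := by
      ext x
      simp [carrier]
    by_cases hcb : c = b
    · subst hcb
      obtain rfl : P = .nil := (Walk.isPath_iff_nil.1 hP.1).eq_nil
      have : carrier (Walk.nil : G.Walk c c) = ∅ := by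
        ext x
        simp [carrier]
      rw [hcar, this, union_empty]
      exact arcBetween_cell h
    · rw [hcar]
      refine (arcBetween_cell h).trans (ih hP.1 hcb) ?_
      rintro x hx ⟨f, hf, hxf⟩
      have hne : s(a, c) ≠ f := by
        rintro rfl
        exact hP.2 (P.fst_mem_support_of_mem_edges hf)
      obtain ⟨v, hv, hvf, rfl⟩ := eq_vertex_of_mem_cell hne hx hxf
      rcases Sym2.mem_iff.1 hv with rfl | rfl
      · exact absurd (mem_support_of_mem hf hvf) hP.2
      · rfl

lemma eq_vertex_of_mem_carrier {a b c d : V} {P : G.Walk a b} {Q : G.Walk c d}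
    (h : InternallyDisjoint P Q) {x : OneComplex G} (hP : x ∈ carrier P) (hQ : x ∈ carrier Q) :
    ∃ v, x = vertex G v ∧ (v = a ∨ v = b) ∧ (v = c ∨ v = d) := by
  obtain ⟨e, he, hxe⟩ := hP
  obtain ⟨f, hf, hxf⟩ := hQ
  obtain ⟨v, hve, hvf, rfl⟩ := eq_vertex_of_mem_cell (by rintro rfl; exact h.1 he hf) hxe hxf
  exact ⟨v, rfl, h.2 v (mem_support_of_mem he hve) (mem_support_of_mem hf hvf)⟩

end OneComplex

end OneComplex
/-! ### Arcs and components -/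

section Components

open Set

/-- Removing two parameters leaves at most three pieces of the interval, so two of four parameters
are in the same piece; the subarc between them is connected and avoids `a` and `b`. -/
lemma exists_joined_of_isArc {X : Type u} [TopologicalSpace X] {a b : X} {A : Set X} (hA : IsArc A)
    (x : Fin 4 → ({a, b}ᶜ : Set X)) (hx : ∀ i, (x i : X) ∈ A) :
    ∃ i j, i ≠ j ∧ (x i : ConnectedComponents ({a, b}ᶜ : Set X)) = x j := by
  obtain ⟨φ⟩ := hA
  let γ : unitInterval → X := fun t => φ.symm t
  have hγc : Continuous γ := continuous_subtype_val.comp φ.symm.continuous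
  have hγi : Function.Injective γ := Subtype.val_injective.comp φ.symm.injective
  let t : Fin 4 → unitInterval := fun i => φ ⟨x i, hx i⟩
  have ht : ∀ i, γ (t i) = x i := fun i => by simp [γ, t]
  -- If `c` is not on the arc, any `r` will do, and `0` is taken.
  have hpar : ∀ c : X, ∃ r, ∀ s, γ s = c → s = r := fun c => by
    by_cases h : ∃ r, γ r = c
    · obtain ⟨r, rfl⟩ := h
      exact ⟨r, fun s hs => hγi hs⟩
    · exact ⟨0, fun s hs => absurd ⟨s, hs⟩ h⟩
  obtain ⟨r, hr⟩ := hpar a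
  obtain ⟨r', hr'⟩ := hpar b
  -- The number of cut parameters below `t i` names the piece. It is monotone in `t i` and jumps at
  -- each cut, so equal values leave no cut in between.
  let g : Fin 4 → ℕ := fun i => (if r < t i then 1 else 0) + (if r' < t i then 1 else 0)
  have hg : ∀ i ∈ (Finset.univ : Finset (Fin 4)), g i ∈ Finset.range 3 := by
    intro i _
    simp only [g, Finset.mem_range]
    split_ifs <;> norm_num
  obtain ⟨i, -, j, -, hij, hgij⟩ :=
    Finset.exists_ne_map_eq_of_card_lt_of_maps_to (by simp) hg
  refine ⟨i, j, hij, ?_⟩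
  wlog hle : t i ≤ t j generalizing i j
  · exact (this j i hij.symm hgij.symm (le_of_not_ge hle)).symm
  have hxa : ∀ i, γ (t i) ≠ a := fun i h => (x i).2 (by simp [← ht, h])
  have hxb : ∀ i, γ (t i) ≠ b := fun i h => (x i).2 (by simp [← ht, h])
  have havoid : ∀ s ∈ Icc (t i) (t j), γ s ∈ ({a, b}ᶜ : Set X) := by
    rintro s ⟨h1, h2⟩ hs
    have h1' : t i < s ∧ s < t j := by
      have hne : ∀ i, s ≠ t i := by
        rintro k rfl
        rcases hs with h | h
        · exact hxa k h
        · exact hxb k h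
      exact ⟨lt_of_le_of_ne h1 (hne i).symm, lt_of_le_of_ne h2 (hne j)⟩
    have hrs : s = r ∨ s = r' := hs.imp (hr s) (hr' s)
    have m1 : r < t i → r < t j := fun h => h.trans_le hle
    have m2 : r' < t i → r' < t j := fun h => h.trans_le hle
    simp only [g] at hgij
    rcases hrs with rfl | rfl
    · rw [if_neg (not_lt.2 h1), if_pos h1'.2] at hgij
      split_ifs at hgij with h h' <;> first | omega | exact h' (m2 h)
    · rw [if_neg (not_lt.2 h1), if_pos h1'.2] at hgij
      split_ifs at hgij with h h' <;> first | omega | exact h' (m1 h)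
  have hpre : IsPreconnected (γ '' Icc (t i) (t j)) :=
    isPreconnected_Icc.image γ hγc.continuousOn
  have hsub : IsPreconnected ((↑) ⁻¹' (γ '' Icc (t i) (t j)) : Set ({a, b}ᶜ : Set X)) := by
    rw [← Topology.IsInducing.subtypeVal.isPreconnected_image, Subtype.image_preimage_coe,
      inter_eq_right.2]
    · exact hpre
    · rintro _ ⟨s, hs, rfl⟩
      exact havoid s hs
  rw [ConnectedComponents.coe_eq_coe']
  exact hsub.subset_connectedComponent (x := x j) ⟨t j, ⟨hle, le_rfl⟩, ht j⟩
    ⟨t i, ⟨le_rfl, hle⟩, ht i⟩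

theorem IsArcConnected.not_cutsIntoAtLeast {X : Type u} [TopologicalSpace X]
    (hX : IsArcConnected 4 X) (a b : X) : ¬ CutsIntoAtLeast ({a, b} : Set X) 4 := by
  intro h
  rw [CutsIntoAtLeast, ← encard_univ] at h
  obtain ⟨T, -, hT⟩ := exists_subset_encard_eq h
  have hfin : T.Finite := finite_of_encard_eq_coe hT
  have hcard : hfin.toFinset.card = 4 := by
    rw [hfin.encard_eq_coe_toFinset_card] at hT
    exact_mod_cast hT
  let c : Fin 4 → ConnectedComponents ({a, b}ᶜ : Set X) :=
    fun i => (hfin.toFinset.equivFinOfCardEq hcard).symm i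
  have hc : Function.Injective c :=
    Subtype.val_injective.comp (hfin.toFinset.equivFinOfCardEq hcard).symm.injective
  choose x hx using fun i => ConnectedComponents.surjective_coe (c i)
  obtain ⟨A, hA, hsub⟩ := hX (range fun i => (x i : X)) (by
    rw [← image_univ]
    refine (encard_image_le _ _).trans ?_
    simp [encard_univ])
  obtain ⟨i, j, hij, h⟩ := exists_joined_of_isArc hA x fun i => hsub ⟨i, rfl⟩
  rw [hx, hx] at h
  exact hij (hc h)

/-! ### From edges separated in the graph to components of the one-complex -/

open SimpleGraph OneComplex

/-- If no two of the four edges are joined off `a` and `b`, their midpoints lie in four different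
components. To separate `e i` from `e j`, a function `bumpFun` is made positive on whatever is
reachable from `e i`, negative on the rest and zero only at `a` and `b`; the intermediate value
theorem does the rest. -/
lemma noFourCut_of_not_cutsIntoAtLeast {V : Type u} {G : SimpleGraph V}
    (h : ¬ ∃ a b : V, a ≠ b ∧
      CutsIntoAtLeast ({vertex G a, vertex G b} : Set (OneComplex G)) 4) : NoFourCut G := by
  classical
  intro a b hab e hinj he
  by_contra! hno
  refine h ⟨a, b, hab, ?_⟩
  let half : unitInterval := ⟨1 / 2, by norm_num, by norm_num⟩
  have hhalf : (half : ℝ) = 1 / 2 := rfl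
  have hmem : ∀ i, edgePoint G ⟨e i, he i⟩ half ∈ ({vertex G a, vertex G b}ᶜ : Set (OneComplex G)) :=
    fun i hi => by
      rcases hi with hi | hi <;>
        exact edgePoint_ne_vertex (by rw [hhalf]; norm_num) (by rw [hhalf]; norm_num) _ hi
  let y : Fin 4 → ({vertex G a, vertex G b}ᶜ : Set (OneComplex G)) := fun i => ⟨_, hmem i⟩
  have hy : Function.Injective
      fun i => (y i : ConnectedComponents ({vertex G a, vertex G b}ᶜ : Set (OneComplex G))) := by
    intro i j hyij
    by_contra hij
    let L : V → Prop := fun v => ∃ x ∈ e i, ∃ W : G.Walk x v, a ∉ W.support ∧ b ∉ W.support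
    -- The edge `e i` is listed separately, because both its ends may be in `{a, b}`, and then no
    -- vertex satisfies `L`.
    let M : G.edgeSet → Prop := fun f => f.1 = e i ∨ ∃ z ∈ f.1, L z
    have hLM : ∀ (f : G.edgeSet) (z : V), z ∈ f.1 → z ≠ a → z ≠ b → (M f ↔ L z) := by
      intro f z hz hza hzb
      refine ⟨?_, fun h => .inr ⟨z, hz, h⟩⟩
      rintro (h | ⟨w, hw, x, hx, W, haW, hbW⟩)
      · exact ⟨z, h ▸ hz, .nil, by simp [hza.symm], by simp [hzb.symm]⟩
      · by_cases hwz : w = z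
        · exact hwz ▸ ⟨x, hx, W, haW, hbW⟩
        · have hadj : G.Adj w z := by
            rw [← mem_edgeSet, ← (Sym2.mem_and_mem_iff hwz).1 ⟨hw, hz⟩]
            exact f.2
          exact ⟨x, hx, W.concat hadj, by simp [haW, hza.symm], by simp [hbW, hzb.symm]⟩
    have hMi : M ⟨e i, he i⟩ := .inl rfl
    have hMj : ¬ M ⟨e j, he j⟩ := by
      rintro (h | ⟨z, hz, x, hx, W, haW, hbW⟩)
      · exact hij (hinj h).symm
      · exact hbW (hno i j hij x hx z hz W haW)
    let α : V → ℝ := fun v => if v = a ∨ v = b then 0 else if L v then 1 else -1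
    let β : G.edgeSet → ℝ := fun f => if M f then 1 else -1
    have hpos : ∀ (f : G.edgeSet) (t : unitInterval), 0 < (t : ℝ) → (t : ℝ) < 1 → M f →
        0 < bumpFun α β (edgePoint G f t) := by
      intro f t h0 h1 hf
      have hα : ∀ z ∈ f.1, 0 ≤ α z := by
        intro z hz
        simp only [α]
        split_ifs with h h'
        · exact le_rfl
        · exact zero_le_one
        · push Not at h
          exact absurd ((hLM f z hz h.1 h.2).1 hf) h'
      have hs := mul_nonneg (sub_pos.2 h1).le (hα (src f) (mem_edge_iff.2 (.inl rfl)))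
      have ht := mul_nonneg h0.le (hα (tgt f) (mem_edge_iff.2 (.inr rfl)))
      have := mul_pos h0 (sub_pos.2 h1)
      rw [bumpFun_edgePoint, show β f = 1 from if_pos hf]
      linarith
    have hneg : ∀ (f : G.edgeSet) (t : unitInterval), 0 < (t : ℝ) → (t : ℝ) < 1 → ¬ M f →
        bumpFun α β (edgePoint G f t) < 0 := by
      intro f t h0 h1 hf
      have hα : ∀ z ∈ f.1, α z ≤ 0 := by
        intro z hz
        simp only [α]
        split_ifs with h h'
        · exact le_rfl
        · push Not at h
          exact absurd ((hLM f z hz h.1 h.2).2 h') hf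
        · norm_num
      have hs := mul_nonneg (sub_pos.2 h1).le (neg_nonneg.2 (hα (src f) (mem_edge_iff.2 (.inl rfl))))
      have ht := mul_nonneg h0.le (neg_nonneg.2 (hα (tgt f) (mem_edge_iff.2 (.inr rfl))))
      have := mul_pos h0 (sub_pos.2 h1)
      rw [bumpFun_edgePoint, show β f = -1 from if_neg hf]
      linarith
    have hne : ∀ x : ({vertex G a, vertex G b}ᶜ : Set (OneComplex G)), bumpFun α β x ≠ 0 := by
      rintro ⟨x, hx⟩
      rcases eq_vertex_or_edgePoint x with ⟨v, rfl⟩ | ⟨f, t, h0, h1, rfl⟩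
      · have hv : ¬ (v = a ∨ v = b) := by
          rintro (rfl | rfl) <;> simp at hx
        simp only [bumpFun_vertex, α, if_neg hv]
        split_ifs <;> norm_num
      · by_cases hf : M f
        · exact (hpos f t h0 h1 hf).ne'
        · exact (hneg f t h0 h1 hf).ne
    rw [ConnectedComponents.coe_eq_coe'] at hyij
    have hcont : Continuous fun x : ({vertex G a, vertex G b}ᶜ : Set (OneComplex G)) =>
        bumpFun α β x := (continuous_bumpFun α β).comp continuous_subtype_val
    have hval := isPreconnected_connectedComponent.intermediate_value
      (mem_connectedComponent (x := y j)) hyij hcont.continuousOn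
    obtain ⟨x, -, hx⟩ := hval (show (0 : ℝ) ∈ Icc (bumpFun α β (y j)) (bumpFun α β (y i)) from
      ⟨(hneg _ half (by rw [hhalf]; norm_num) (by rw [hhalf]; norm_num) hMj).le,
        (hpos _ half (by rw [hhalf]; norm_num) (by rw [hhalf]; norm_num) hMi).le⟩)
    exact hne x hx
  rw [CutsIntoAtLeast]
  have := ENat.card_le_card_of_injective hy
  simpa using this

end Components

/-! ### Arcs in basic subgraphs -/

section Basic

open Set SimpleGraph OneComplex

variable {V : Type u} {G : SimpleGraph V}

/-- This forgets the graph: there remain arcs whose intersections are governed by the pattern `s`,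
`t`, so that the disjointness conditions for a concrete curve can be decided on `Fin n`. -/
lemma IsSubdivisionOf.exists_arcs {n k : ℕ} {s t : Fin k → Fin n} {H : G.Subgraph}
    (h : IsSubdivisionOf s t H) (hst : ∀ i, s i ≠ t i) :
    ∃ (p : Fin n → OneComplex G) (A : Fin k → Set (OneComplex G)),
      (∀ i, ArcBetween (p (s i)) (p (t i)) (A i)) ∧
      (∀ i j, i ≠ j → ∀ z ∈ A i, z ∈ A j →
        ∃ m, z = p m ∧ (m = s i ∨ m = t i) ∧ (m = s j ∨ m = t j)) ∧
      ∀ z, ∀ e ∈ H.edgeSet, z ∈ cell G e → ∃ i, z ∈ A i := by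
  obtain ⟨φ, P, hφ, hP, -, hd, -, hE⟩ := h
  refine ⟨fun m => vertex G (φ m), fun i => carrier (P i),
    fun i => arcBetween_carrier (hP i) (hφ.ne (hst i)), fun i j hij z hz hz' => ?_,
    fun z e he hz => ?_⟩
  · obtain ⟨v, rfl, h1, h2⟩ := eq_vertex_of_mem_carrier (hd i j hij) hz hz'
    rcases h1 with rfl | rfl
    · exact ⟨s i, rfl, .inl rfl, h2.imp (hφ ·) (hφ ·)⟩
    · exact ⟨t i, rfl, .inr rfl, h2.imp (hφ ·) (hφ ·)⟩
  · rw [hE] at he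
    obtain ⟨i, hi⟩ := he
    exact ⟨i, e, hi, hz⟩

/-- Consequences of the intersection pattern of the arcs of a subdivision. -/
lemma forall_inter_of_pattern {X : Type u} {n k : ℕ} {s t : Fin k → Fin n} {p : Fin n → X}
    {A : Fin k → Set X}
    (hd : ∀ i j, i ≠ j → ∀ z ∈ A i, z ∈ A j →
      ∃ m, z = p m ∧ (m = s i ∨ m = t i) ∧ (m = s j ∨ m = t j)) (i j : Fin k) (hij : i ≠ j) :
    (∀ x y, (∀ m, (m = s i ∨ m = t i) → (m = s j ∨ m = t j) → m = x ∨ m = y) →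
      ∀ z ∈ A i, z ∈ A j → z = p x ∨ z = p y) ∧
    (∀ x, (∀ m, (m = s i ∨ m = t i) → (m = s j ∨ m = t j) → m = x) →
      ∀ z ∈ A i, z ∈ A j → z = p x) ∧
    ((∀ m, (m = s i ∨ m = t i) → (m = s j ∨ m = t j) → False) → ∀ z ∈ A i, z ∉ A j) := by
  refine ⟨fun x y h z hz hz' => ?_, fun x h z hz hz' => ?_, fun h z hz hz' => ?_⟩ <;>
    obtain ⟨m, rfl, h1, h2⟩ := hd i j hij z hz hz'
  · exact (h m h1 h2).imp (congrArg p) (congrArg p)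
  · exact congrArg p (h m h1 h2)
  · exact h m h1 h2

/-- A baguette curve without one of the two arms of a circle is a theta-curve. -/
lemma inArc_of_theta'' {X : Type u} [TopologicalSpace X] [T2Space X] {x y w w' : X}
    {A B C D E S : Set X} (hA : ArcBetween x y A)
    (hB : ArcBetween x y B) (hC : ArcBetween x w C) (hD : ArcBetween w w' D)
    (hE : ArcBetween w' y E) (hS : S.Finite)
    (hAB : ∀ z ∈ A, z ∈ B → z = x ∨ z = y)
    (hAC : ∀ z ∈ A, z ∈ C → z = x) (hBC : ∀ z ∈ B, z ∈ C → z = x)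
    (hAD : ∀ z ∈ A, z ∉ D) (hBD : ∀ z ∈ B, z ∉ D)
    (hAE : ∀ z ∈ A, z ∈ E → z = y) (hBE : ∀ z ∈ B, z ∈ E → z = y)
    (hCD : ∀ z ∈ C, z ∈ D → z = w) (hDE : ∀ z ∈ D, z ∈ E → z = w') (hCE : ∀ z ∈ C, z ∉ E)
    (hcov : ∀ z ∈ S, z ∈ A ∨ z ∈ B ∨ z ∈ C ∨ z ∈ D ∨ z ∈ E) : InArc S := by
  refine inArc_of_theta' hA hB hC (hD.trans hE hDE) hS hAB (fun z h h' => .inl (hAC z h h'))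
    (fun z h h' => .inl (hBC z h h')) ?_ ?_ ?_ hcov
  · rintro z h (h' | h')
    · exact absurd h' (hAD z h)
    · exact .inr (hAE z h h')
  · rintro z h (h' | h')
    · exact absurd h' (hBD z h)
    · exact .inr (hBE z h h')
  · rintro z h (h' | h')
    · exact hCD z h h'
    · exact absurd h' (hCE z h)

variable {V : Type u} {G : SimpleGraph V}

/-- Four points do not need all five arcs. Without an arm of a circle the curve is a theta-curve,
without the link a figure eight. -/
lemma IsHappyFace.inArc {H : G.Subgraph} (h : IsHappyFace H) {S : Set (OneComplex G)}
    (hS : S.encard ≤ 4) (hSH : ∀ z ∈ S, ∃ e ∈ H.edgeSet, z ∈ cell G e) : InArc S := by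
  have hfin : S.Finite := finite_of_encard_le_coe hS
  obtain ⟨p, A, hA, hd, hcov⟩ := h.exists_arcs (by decide)
  have key := forall_inter_of_pattern hd
  have two := fun i j hij => (key i j hij).1
  have one := fun i j hij => (key i j hij).2.1
  obtain ⟨i, hi⟩ := exists_covered_without A (hS.trans_lt (by norm_num)) fun z hz => by
    obtain ⟨e, he, hze⟩ := hSH z hz
    exact hcov z e he hze
  have h0 : ArcBetween (p 0) (p 1) (A 0) := hA 0
  have h1 : ArcBetween (p 0) (p 1) (A 1) := hA 1
  have h2 : ArcBetween (p 0) (p 2) (A 2) := hA 2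
  have h3 : ArcBetween (p 0) (p 2) (A 3) := hA 3
  have h4 : ArcBetween (p 1) (p 2) (A 4) := hA 4
  simp only [Fin.exists_fin_succ, Fin.exists_fin_zero] at hi
  fin_cases i
  · refine inArc_of_theta' h2 h3 h1 h4 hfin (two _ _ ?_ _ _ ?_) (two _ _ ?_ _ _ ?_)
      (two _ _ ?_ _ _ ?_) (two _ _ ?_ _ _ ?_) (two _ _ ?_ _ _ ?_) (one _ _ ?_ _ ?_) ?_
    on_goal 13 => intro z hz; have := hi z hz; simp at this; tauto
    all_goals decide
  · refine inArc_of_theta' h2 h3 h0 h4 hfin (two _ _ ?_ _ _ ?_) (two _ _ ?_ _ _ ?_)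
      (two _ _ ?_ _ _ ?_) (two _ _ ?_ _ _ ?_) (two _ _ ?_ _ _ ?_) (one _ _ ?_ _ ?_) ?_
    on_goal 13 => intro z hz; have := hi z hz; simp at this; tauto
    all_goals decide
  · refine inArc_of_theta' h0 h1 h3 h4.symm hfin (two _ _ ?_ _ _ ?_) (two _ _ ?_ _ _ ?_)
      (two _ _ ?_ _ _ ?_) (two _ _ ?_ _ _ ?_) (two _ _ ?_ _ _ ?_) (one _ _ ?_ _ ?_) ?_
    on_goal 13 => intro z hz; have := hi z hz; simp at this; tauto
    all_goals decide
  · refine inArc_of_theta' h0 h1 h2 h4.symm hfin (two _ _ ?_ _ _ ?_) (two _ _ ?_ _ _ ?_)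
      (two _ _ ?_ _ _ ?_) (two _ _ ?_ _ _ ?_) (two _ _ ?_ _ _ ?_) (one _ _ ?_ _ ?_) ?_
    on_goal 13 => intro z hz; have := hi z hz; simp at this; tauto
    all_goals decide
  · refine inArc_of_figureEight h0 h1 h2 h3 hfin (two _ _ ?_ _ _ ?_) (two _ _ ?_ _ _ ?_)
      (one _ _ ?_ _ ?_) (one _ _ ?_ _ ?_) (one _ _ ?_ _ ?_) (one _ _ ?_ _ ?_) ?_
    on_goal 13 => intro z hz; have := hi z hz; simp at this; tauto
    all_goals decide

/-- One of the six arcs can be dropped. Without an arm of a circle the curve is a theta-curve,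
without a link a dumbbell. -/
lemma IsBaguette.inArc {H : G.Subgraph} (h : IsBaguette H) {S : Set (OneComplex G)}
    (hS : S.encard ≤ 4) (hSH : ∀ z ∈ S, ∃ e ∈ H.edgeSet, z ∈ cell G e) : InArc S := by
  have hfin : S.Finite := finite_of_encard_le_coe hS
  obtain ⟨p, A, hA, hd, hcov⟩ := h.exists_arcs (by decide)
  have key := forall_inter_of_pattern hd
  have two := fun i j hij => (key i j hij).1
  have one := fun i j hij => (key i j hij).2.1
  have none := fun i j hij => (key i j hij).2.2
  obtain ⟨i, hi⟩ := exists_covered_without A (hS.trans_lt (by norm_num)) fun z hz => by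
    obtain ⟨e, he, hze⟩ := hSH z hz
    exact hcov z e he hze
  have h0 : ArcBetween (p 0) (p 1) (A 0) := hA 0
  have h1 : ArcBetween (p 0) (p 1) (A 1) := hA 1
  have h2 : ArcBetween (p 2) (p 3) (A 2) := hA 2
  have h3 : ArcBetween (p 2) (p 3) (A 3) := hA 3
  have h4 : ArcBetween (p 0) (p 2) (A 4) := hA 4
  have h5 : ArcBetween (p 1) (p 3) (A 5) := hA 5
  simp only [Fin.exists_fin_succ, Fin.exists_fin_zero] at hi
  fin_cases i
  · refine inArc_of_theta'' h2 h3 h4.symm h1 h5 hfin (two _ _ ?_ _ _ ?_) (one _ _ ?_ _ ?_)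
      (one _ _ ?_ _ ?_) (none _ _ ?_ ?_) (none _ _ ?_ ?_) (one _ _ ?_ _ ?_) (one _ _ ?_ _ ?_)
      (one _ _ ?_ _ ?_) (one _ _ ?_ _ ?_) (none _ _ ?_ ?_) ?_
    on_goal 21 => intro z hz; have := hi z hz; simp at this; tauto
    all_goals decide
  · refine inArc_of_theta'' h2 h3 h4.symm h0 h5 hfin (two _ _ ?_ _ _ ?_) (one _ _ ?_ _ ?_)
      (one _ _ ?_ _ ?_) (none _ _ ?_ ?_) (none _ _ ?_ ?_) (one _ _ ?_ _ ?_) (one _ _ ?_ _ ?_)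
      (one _ _ ?_ _ ?_) (one _ _ ?_ _ ?_) (none _ _ ?_ ?_) ?_
    on_goal 21 => intro z hz; have := hi z hz; simp at this; tauto
    all_goals decide
  · refine inArc_of_theta'' h0 h1 h4 h3 h5.symm hfin (two _ _ ?_ _ _ ?_) (one _ _ ?_ _ ?_)
      (one _ _ ?_ _ ?_) (none _ _ ?_ ?_) (none _ _ ?_ ?_) (one _ _ ?_ _ ?_) (one _ _ ?_ _ ?_)
      (one _ _ ?_ _ ?_) (one _ _ ?_ _ ?_) (none _ _ ?_ ?_) ?_
    on_goal 21 => intro z hz; have := hi z hz; simp at this; tauto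
    all_goals decide
  · refine inArc_of_theta'' h0 h1 h4 h2 h5.symm hfin (two _ _ ?_ _ _ ?_) (one _ _ ?_ _ ?_)
      (one _ _ ?_ _ ?_) (none _ _ ?_ ?_) (none _ _ ?_ ?_) (one _ _ ?_ _ ?_) (one _ _ ?_ _ ?_)
      (one _ _ ?_ _ ?_) (one _ _ ?_ _ ?_) (none _ _ ?_ ?_) ?_
    on_goal 21 => intro z hz; have := hi z hz; simp at this; tauto
    all_goals decide
  · refine inArc_of_dumbbell h0 h1 h2 h3 h5 hfin (two _ _ ?_ _ _ ?_) (two _ _ ?_ _ _ ?_)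
      (none _ _ ?_ ?_) (none _ _ ?_ ?_) (none _ _ ?_ ?_) (none _ _ ?_ ?_)
      (one _ _ ?_ _ ?_) (one _ _ ?_ _ ?_) (one _ _ ?_ _ ?_) (one _ _ ?_ _ ?_) ?_
    on_goal 21 => intro z hz; have := hi z hz; simp at this; tauto
    all_goals decide
  · refine inArc_of_dumbbell h0.symm h1.symm h2.symm h3.symm h4 hfin (two _ _ ?_ _ _ ?_)
      (two _ _ ?_ _ _ ?_) (none _ _ ?_ ?_) (none _ _ ?_ ?_) (none _ _ ?_ ?_) (none _ _ ?_ ?_)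
      (one _ _ ?_ _ ?_) (one _ _ ?_ _ ?_) (one _ _ ?_ _ ?_) (one _ _ ?_ _ ?_) ?_
    on_goal 21 => intro z hz; have := hi z hz; simp at this; tauto
    all_goals decide

lemma IsTheta.inArc {H : G.Subgraph} (h : IsTheta H) {S : Set (OneComplex G)}
    (hfin : S.Finite) (hSH : ∀ z ∈ S, ∃ e ∈ H.edgeSet, z ∈ cell G e) : InArc S := by
  obtain ⟨p, A, hA, hd, hcov⟩ := h.exists_arcs (by decide)
  have two := fun i j hij => (forall_inter_of_pattern hd i j hij).1
  have h0 : ArcBetween (p 0) (p 1) (A 0) := hA 0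
  have h1 : ArcBetween (p 0) (p 1) (A 1) := hA 1
  have h2 : ArcBetween (p 0) (p 1) (A 2) := hA 2
  refine inArc_of_theta h0 h1 h2 hfin (two _ _ ?_ _ _ ?_) (two _ _ ?_ _ _ ?_) (two _ _ ?_ _ _ ?_) ?_
  on_goal 7 =>
    intro z hz
    obtain ⟨e, he, hze⟩ := hSH z hz
    simpa [Fin.exists_fin_succ, or_assoc] using hcov z e he hze
  all_goals decide

lemma IsCircle.inArc {H : G.Subgraph} (h : IsCircle H) {S : Set (OneComplex G)}
    (hfin : S.Finite) (hSH : ∀ z ∈ S, ∃ e ∈ H.edgeSet, z ∈ cell G e) : InArc S := by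
  obtain ⟨x, c, hc, rfl⟩ := h
  have hne : x ≠ c.snd := (c.adj_snd hc.not_nil).ne
  obtain ⟨P, Q, hP, hQ, hPQ, hE, -⟩ := exists_arms_of_isCycle hc c.start_mem_support
    (c.getVert_mem_support 1) hne
  refine inArc_of_circle (arcBetween_carrier hP hne) (arcBetween_carrier hQ hne) hfin
    (fun z hz hz' => ?_) fun z hz => ?_
  · obtain ⟨v, rfl, h, -⟩ := eq_vertex_of_mem_carrier hPQ hz hz'
    exact h.imp (congrArg _) (congrArg _)
  · obtain ⟨e, he, hze⟩ := hSH z hz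
    rw [Walk.mem_edges_toSubgraph, hE] at he
    exact he.imp (fun h => ⟨e, h, hze⟩) fun h => ⟨e, h, hze⟩

lemma IsBasicFourAC.inArc {H : G.Subgraph} (h : IsBasicFourAC H) {S : Set (OneComplex G)}
    (hS : S.encard ≤ 4) (hSH : ∀ z ∈ S, ∃ e ∈ H.edgeSet, z ∈ cell G e) : InArc S := by
  have hfin : S.Finite := finite_of_encard_le_coe hS
  rcases h with h | h | h | h
  exacts [h.inArc hfin hSH, h.inArc hfin hSH, h.inArc hS hSH, h.inArc hS hSH]

/-! ### From points of the one-complex to sets of four edges -/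

lemma CyclicallyConnected.exists_mem_cell (hG : CyclicallyConnected G) (x : OneComplex G) :
    ∃ e ∈ G.edgeSet, x ∈ cell G e := by
  rcases eq_vertex_or_edgePoint x with ⟨v, rfl⟩ | ⟨e, t, -, -, rfl⟩
  · obtain ⟨y, c, hc, hv, -⟩ := hG v v
    obtain ⟨e, he, hve⟩ := (Walk.mem_support_iff_exists_mem_edges_of_not_nil hc.not_nil).1 hv
    have heG := c.edges_subset_edgeSet he
    exact ⟨e, heG, vertex_mem_cell heG hve⟩
  · exact ⟨e.1, e.2, e.2, t, rfl⟩

/-- Choose an edge through each point and enlarge the set of these edges to exactly four. If the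
graph has fewer than four edges, it has no edges beyond those of a triangle, which is itself a basic
subgraph. -/
lemma CyclicallyConnected.isArcConnected_four [Nonempty V] (hG : CyclicallyConnected G)
    (h : ∀ F : Finset (Sym2 V), (F : Set (Sym2 V)) ⊆ G.edgeSet → F.card = 4 →
      ∃ H : G.Subgraph, IsBasicFourAC H ∧ (F : Set (Sym2 V)) ⊆ H.edgeSet) :
    IsArcConnected 4 (OneComplex G) := by
  classical
  intro S hS
  have hfin : S.Finite := finite_of_encard_le_coe hS
  choose f hfG hf using hG.exists_mem_cell
  by_cases h4 : (4 : ℕ∞) ≤ G.edgeSet.encard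
  · obtain ⟨F, hSF, hFG, hF⟩ := exists_superset_subset_encard_eq (s := f '' S)
      (by rintro _ ⟨x, -, rfl⟩; exact hfG x) ((encard_image_le f S).trans hS) h4
    have hFfin : F.Finite := finite_of_encard_eq_coe (k := 4) hF
    obtain ⟨H, hH, hFH⟩ := h hFfin.toFinset (by simpa using hFG) (by
      rw [hFfin.encard_eq_coe_toFinset_card] at hF
      exact_mod_cast hF)
    exact hH.inArc hS fun z hz => ⟨f z, hFH (by simpa using hSF ⟨z, hz, rfl⟩), hf z⟩
  -- A cycle has at least three edges and the graph at most three, so the cycle uses all of them.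
  · obtain ⟨v⟩ := ‹Nonempty V›
    obtain ⟨y, c, hc, -, -⟩ := hG v v
    have hcard : c.edges.toFinset.card = c.length := by
      rw [List.toFinset_card_of_nodup hc.isTrail.edges_nodup, Walk.length_edges]
    have hlt : G.edgeSet.encard ≤ 3 := by
      rw [not_le] at h4
      exact Order.le_of_lt_add_one h4
    have hEfin : G.edgeSet.Finite := finite_of_encard_le_coe (k := 3) hlt
    have hall : (c.edges.toFinset : Set (Sym2 V)) = G.edgeSet := by
      refine hEfin.eq_of_subset_of_encard_le' ?_ ?_
      · intro e he
        exact c.edges_subset_edgeSet (by simpa using he)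
      · rw [encard_coe_eq_coe_finsetCard, hcard]
        exact hlt.trans (by exact_mod_cast hc.three_le_length)
    refine IsBasicFourAC.inArc (.inl ⟨y, c, hc, rfl⟩) hS fun z _ => ⟨f z, ?_, hf z⟩
    have := hfG z
    rw [← hall] at this
    simpa using this

end Basic
end ArcGraph

theorem mainTheorem5 {V : Type*} [Nonempty V] (G : SimpleGraph V)
    (hG : ArcGraph.CyclicallyConnected G) :
    List.TFAE [
      ArcGraph.IsArcConnected 4 (ArcGraph.OneComplex G),
      ¬ ∃ a b : V, a ≠ b ∧
        ArcGraph.CutsIntoAtLeast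
          ({ArcGraph.OneComplex.vertex G a, ArcGraph.OneComplex.vertex G b} :
            Set (ArcGraph.OneComplex G)) 4,
      ∀ F : Finset (Sym2 V), (F : Set (Sym2 V)) ⊆ G.edgeSet → F.card = 4 →
        ∃ H : G.Subgraph, ArcGraph.IsBasicFourAC H ∧ (F : Set (Sym2 V)) ⊆ H.edgeSet] := by
  tfae_have 1 → 2 := by
    rintro h ⟨a, b, -, hab⟩
    exact h.not_cutsIntoAtLeast _ _ hab
  tfae_have 2 → 3 := by
    intro h F hF hcard
    obtain ⟨H, hH, hFH⟩ := hG.inBasic_range (ArcGraph.noFourCut_of_not_cutsIntoAtLeast h)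
      (fun i => (F.equivFinOfCardEq hcard).symm i) fun i => hF ((F.equivFinOfCardEq hcard).symm i).2
    refine ⟨H, hH, fun e he => hFH ⟨F.equivFinOfCardEq hcard ⟨e, he⟩, ?_⟩⟩
    simp
  tfae_have 3 → 1 := hG.isArcConnected_four
  tfae_finish
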